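/- Suppose that there is a Suslin line (a linearly ordered set whose order topology satisfies the countable chain condition, i.e. every family of pairwise disjoint nonempty open sets is countable, but is not separable), or that the Continuum Hypothesis $2^{\aleph_0}=\aleph_1$ holds. Then there is a $\sigma$-compact, hereditarily Lindelöf $T_3$ space $X$ (regular and $T_1$) such that the closure in $X$ of every discrete subset of $X$ (every subset that is discrete in its subspace topology) is first countable in its subspace topology, but $X$ is not countably tight; that is, there are a set $A\subseteq X$ and a point $x\in\overline{A}$ such that $x\notin\overline{B}$ for every countable $B\subseteq A$. -/

import Mathlib

open scoped Cardinal

universe u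

/-- The countable chain condition: every family of pairwise disjoint nonempty open sets is
countable. -/
def CountableChainCondition (X : Type u) [TopologicalSpace X] : Prop :=
  ∀ 𝒰 : Set (Set X), (∀ U ∈ 𝒰, IsOpen U ∧ U.Nonempty) → 𝒰.PairwiseDisjoint id → 𝒰.Countable

/-- A Suslin line: a linearly ordered set whose order topology satisfies the countable chain
condition but is not separable. -/
def IsSuslinLine (L : Type u) [LinearOrder L] : Prop :=
  letI : TopologicalSpace L := Preorder.topology L
  CountableChainCondition L ∧ ¬ TopologicalSpace.SeparableSpace L

/-- The Continuum Hypothesis: the cardinality of the continuum is the first uncountable cardinal. -/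
def ContinuumHypothesis : Prop := Cardinal.continuum.{0} = ℵ₁

/-- A space is countably tight if every point in the closure of a set `A` is in the closure of a
countable subset of `A`. -/
def CountablyTight (X : Type u) [TopologicalSpace X] : Prop :=
  ∀ (A : Set X) (x : X), x ∈ closure A → ∃ B : Set X, B ⊆ A ∧ B.Countable ∧ x ∈ closure B

open Set Filter Topology MeasureTheory ProbabilityTheory
open scoped ENNReal

/-! Each hypothesis serves only to produce a compact Hausdorff, hereditarily Lindelöf, nonseparable
space `K`; such a `K` is first countable. From a Suslin line, `K` is its Dedekind completion: a ccc
linear order is hereditarily Lindelöf, and a separable first countable completion would make the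
line separable.

Under CH, `K` is a closed subspace `prunedSpace V` of `2^ω₁` carrying a probability measure: at
coordinate `b` a fair coin is tossed, but the value is forced to be `false` on an open set `V b`
determined by earlier coordinates. CH lists all countable families of cylinders, hence all closed
sets determined by countably many coordinates, and `V b` swallows every listed closed set that it
almost contains (`exists_isPruning`). Every point then has only countably many coordinates `true`,
while each `x b = true` has positive measure, so `K` is not separable. A countable subfamily of an
open cover exhausting it in measure misses only points with bounded support
(`IsPruning.hereditarilyLindelofSpace`).

Given `K`, `exists_tower` builds `ω₁` many sequences of open sets `U a n`, decreasing modulo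
finitely many `n`, with points `e a n ∈ U a n` avoided by all later stages. On the closed set `S ⊆ ℕ
× K` spanned fibrewise by these points, the tower generates a filter with open and closed bases that
contains every cocountable set. Adding one point with this neighbourhood filter gives `X`: no
countable set accumulates at the new point, which defeats tightness. Discrete sets in `X` are
countable, so the new point is isolated in their closures whenever it lies there. -/

theorem exists_transfinite_recursion {ι D : Type*} [LinearOrder ι] [WellFoundedLT ι] [Nonempty D]
    (G : ι → (ι → D) → D → Prop)
    (hG : ∀ a f g W, (∀ b < a, f b = g b) → G a f W → G a g W) (h : ∀ a f, ∃ W, G a f W) :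
    ∃ F : ι → D, ∀ a, G a F (F a) := by
  classical
  choose w hw using h
  let F : ι → D := (wellFounded_lt (α := ι)).fix fun a r ↦
    w a fun b ↦ if hb : b < a then r b hb else Classical.arbitrary D
  have hF : ∀ a, F a = w a fun b ↦ if b < a then F b else Classical.arbitrary D := fun a ↦ by
    simp only [F]
    rw [WellFounded.fix_eq]
    simp only [dite_eq_ite]
  refine ⟨F, fun a ↦ ?_⟩
  have h1 := hw a fun b ↦ if b < a then F b else Classical.arbitrary D
  rw [← hF] at h1
  exact hG a _ _ _ (fun b hb ↦ by simp [hb]) h1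

/-- The complement of a point is Lindelöf, so the point is a countable intersection of closed
neighbourhoods; by compactness their finite intersections form a neighbourhood base. -/
theorem firstCountableTopology_of_hereditarilyLindelof (K : Type*) [TopologicalSpace K]
    [CompactSpace K] [T2Space K] [HereditarilyLindelofSpace K] : FirstCountableTopology K := by
  refine ⟨fun x ↦ ?_⟩
  have h : ∀ y : {y // y ≠ x}, ∃ U : Set K, IsOpen U ∧ y.1 ∈ U ∧ Uᶜ ∈ 𝓝 x := fun y ↦ by
    obtain ⟨U, V, hU, hV, hyU, hxV, hd⟩ := t2_separation y.2
    exact ⟨U, hU, hyU, mem_of_superset (hV.mem_nhds hxV) hd.subset_compl_left⟩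
  choose U hUo hyU hUx using h
  obtain ⟨t, ht, hU⟩ := eq_open_union_countable U hUo
  have hsingle : ⋂ i ∈ t, (U i)ᶜ = {x} := by
    have hun : ⋃ i, U i = {x}ᶜ := by
      ext y
      simp only [mem_iUnion, mem_compl_iff, mem_singleton_iff]
      refine ⟨?_, fun hy ↦ ⟨⟨y, hy⟩, hyU _⟩⟩
      rintro ⟨i, hi⟩ rfl
      exact mem_of_mem_nhds (hUx i) hi
    rw [← compl_compl ({x} : Set K), ← hun, ← hU]
    simp
  have hle : 𝓝 x = ⨅ i ∈ t, 𝓟 (U i)ᶜ := by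
    refine le_antisymm (le_iInf₂ fun i _ ↦ le_principal_iff.2 (hUx i)) fun O hO ↦ ?_
    obtain ⟨O', hO'O, hO', hxO'⟩ := mem_nhds_iff.1 hO
    have hcov : O'ᶜ ⊆ ⋃ i : t, U i := by
      intro y hy
      have : y ∉ ⋂ i ∈ t, (U i)ᶜ := by
        rw [hsingle]; rintro rfl; exact hy hxO'
      simpa using this
    obtain ⟨s, hs⟩ := hO'.isClosed_compl.isCompact.elim_finite_subcover _ (fun i : t ↦ hUo i) hcov
    have hmem : (⋂ i ∈ s, (U i.1)ᶜ) ∈ ⨅ i ∈ t, 𝓟 (U i)ᶜ :=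
      (Finset.iInter_mem_sets s).2 fun i _ ↦
        mem_iInf_of_mem i.1 (mem_iInf_of_mem i.2 (mem_principal_self _))
    refine mem_of_superset hmem fun y hy ↦ hO'O ?_
    by_contra hyO
    obtain ⟨i, hi, hyi⟩ := mem_iUnion₂.1 (hs hyO)
    exact (mem_iInter₂.1 hy i hi) hyi
  rw [hle]
  have := ht.to_subtype
  rw [iInf_subtype']
  infer_instance

/-! ### One-point extension of a space by a filter. -/

/-- The space `Y` together with one more point whose punctured neighbourhoods are the members
of `F`. -/
def FilterExtension {Y : Type*} (_F : Filter Y) := Option Y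

namespace FilterExtension

section Basic

variable {Y : Type*} {F : Filter Y}

/-- The inclusion of `Y`. -/
def coe (F : Filter Y) (y : Y) : FilterExtension F := some y

/-- The additional point. -/
def infty (F : Filter Y) : FilterExtension F := none

theorem coe_injective : Function.Injective (coe F) := Option.some_injective Y

@[simp] theorem coe_ne_infty (y : Y) : coe F y ≠ infty F := Option.some_ne_none y

theorem eq_infty_or_coe (x : FilterExtension F) : x = infty F ∨ ∃ y, x = coe F y := by
  cases x with
  | none => exact .inl rfl
  | some y => exact .inr ⟨y, rfl⟩

theorem infty_notMem_image (s : Set Y) : infty F ∉ coe F '' s := by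
  rintro ⟨y, _, h⟩
  exact coe_ne_infty y h

theorem univ_eq : (univ : Set (FilterExtension F)) = {infty F} ∪ range (coe F) := by
  ext x
  rcases eq_infty_or_coe x with rfl | ⟨y, rfl⟩ <;> simp

end Basic

variable {Y : Type*} [TopologicalSpace Y] {F : Filter Y}

instance : TopologicalSpace (FilterExtension F) where
  IsOpen U := IsOpen (coe F ⁻¹' U) ∧ (infty F ∈ U → coe F ⁻¹' U ∈ F)
  isOpen_univ := by simp
  isOpen_inter U V hU hV :=
    ⟨hU.1.inter hV.1, fun h ↦ inter_mem (hU.2 h.1) (hV.2 h.2)⟩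
  isOpen_sUnion S hS := by
    refine ⟨?_, fun ⟨U, hU, h⟩ ↦ mem_of_superset ((hS U hU).2 h) fun y hy ↦ ⟨U, hU, hy⟩⟩
    rw [preimage_sUnion]
    exact isOpen_biUnion fun U hU ↦ (hS U hU).1

theorem isOpen_iff {U : Set (FilterExtension F)} :
    IsOpen U ↔ IsOpen (coe F ⁻¹' U) ∧ (infty F ∈ U → coe F ⁻¹' U ∈ F) := Iff.rfl

theorem isOpenEmbedding_coe : IsOpenEmbedding (coe F) := by
  refine .of_continuous_injective_isOpenMap ⟨fun U hU ↦ hU.1⟩ coe_injective fun U hU ↦ ?_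
  rw [isOpen_iff, preimage_image_eq _ coe_injective]
  exact ⟨hU, fun h ↦ absurd h (infty_notMem_image U)⟩

theorem isClosed_insert_image {T : Set Y} (hT : IsClosed T) :
    IsClosed (insert (infty F) (coe F '' T)) := by
  refine ⟨isOpen_iff.2 ⟨?_, fun h ↦ absurd (mem_insert _ _) h⟩⟩
  convert hT.isOpen_compl using 1
  ext y
  simp [coe_injective.eq_iff]

theorem isClosed_image {T : Set Y} (hT : IsClosed T) (hF : Tᶜ ∈ F) : IsClosed (coe F '' T) := by
  have h : coe F ⁻¹' (coe F '' T)ᶜ = Tᶜ := by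
    rw [preimage_compl, preimage_image_eq _ coe_injective]
  refine ⟨isOpen_iff.2 ⟨?_, fun _ ↦ ?_⟩⟩ <;> rw [h]
  exacts [hT.isOpen_compl, hF]

theorem mem_nhds_infty (ho : ∀ S ∈ F, ∃ T ∈ F, IsOpen T ∧ T ⊆ S) {U : Set (FilterExtension F)} :
    U ∈ 𝓝 (infty F) ↔ infty F ∈ U ∧ coe F ⁻¹' U ∈ F := by
  constructor
  · intro h
    obtain ⟨V, hVU, hV, hm⟩ := mem_nhds_iff.1 h
    exact ⟨hVU hm, mem_of_superset (hV.2 hm) (preimage_mono hVU)⟩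
  · rintro ⟨h, hU⟩
    obtain ⟨T, hT, hTo, hTU⟩ := ho _ hU
    refine mem_nhds_iff.2 ⟨insert (infty F) (coe F '' T), ?_, ?_, mem_insert _ _⟩
    · rintro _ (rfl | ⟨y, hy, rfl⟩)
      exacts [h, hTU hy]
    · have : coe F ⁻¹' insert (infty F) (coe F '' T) = T := by
        ext y; simp [coe_injective.eq_iff]
      rw [isOpen_iff, this]
      exact ⟨hTo, fun _ ↦ hT⟩

theorem sigmaCompactSpace [SigmaCompactSpace Y] : SigmaCompactSpace (FilterExtension F) := by
  rw [← isSigmaCompact_univ_iff, univ_eq, union_eq_iUnion]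
  refine isSigmaCompact_iUnion _ fun b ↦ ?_
  cases b
  · exact isSigmaCompact_range isOpenEmbedding_coe.continuous
  · exact isCompact_singleton.isSigmaCompact

theorem hereditarilyLindelofSpace [HereditarilyLindelofSpace Y] :
    HereditarilyLindelofSpace (FilterExtension F) := by
  refine ⟨fun t _ ↦ ?_⟩
  have : t = (t ∩ {infty F}) ∪ coe F '' (coe F ⁻¹' t) := by
    ext x
    rcases eq_infty_or_coe x with rfl | ⟨y, rfl⟩ <;> simp [coe_injective.eq_iff]
  rw [this]
  exact ((subsingleton_singleton.anti inter_subset_right).countable.isLindelof).union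
    ((HereditarilyLindelofSpace.isLindelof _).image isOpenEmbedding_coe.continuous)

/-- The closed base of `F` gives regularity at the new point. At an old point `y`, a neighbourhood
stays closed in the extension once it misses some member of `F`. -/
theorem t3Space [T3Space Y] (ho : ∀ S ∈ F, ∃ T ∈ F, IsOpen T ∧ T ⊆ S)
    (hc : ∀ S ∈ F, ∃ T ∈ F, IsClosed T ∧ T ⊆ S) (hs : ∀ y : Y, {y}ᶜ ∈ F) :
    T3Space (FilterExtension F) := by
  have : T1Space (FilterExtension F) := by
    refine ⟨fun x ↦ ?_⟩
    rcases eq_infty_or_coe x with rfl | ⟨y, rfl⟩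
    · simpa using isClosed_insert_image (F := F) isClosed_empty
    · simpa using isClosed_image (F := F) (isClosed_singleton (x := y)) (hs y)
  have : RegularSpace (FilterExtension F) := by
    refine RegularSpace.of_exists_mem_nhds_isClosed_subset fun x s hx ↦ ?_
    rcases eq_infty_or_coe x with rfl | ⟨y, rfl⟩
    · obtain ⟨h, hF⟩ := (mem_nhds_infty ho).1 hx
      obtain ⟨T, hT, hTc, hTs⟩ := hc _ hF
      refine ⟨_, (mem_nhds_infty ho).2 ⟨mem_insert _ (coe F '' T), ?_⟩,
        isClosed_insert_image hTc, ?_⟩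
      · exact mem_of_superset hT fun y hy ↦ .inr ⟨y, hy, rfl⟩
      · rintro _ (rfl | ⟨y, hy, rfl⟩)
        exacts [h, hTs hy]
    · obtain ⟨T, hT, hTc, hTs⟩ := hc _ (hs y)
      have h1 : coe F ⁻¹' s ∩ Tᶜ ∈ 𝓝 y :=
        inter_mem (isOpenEmbedding_coe.continuous.continuousAt hx)
          (hTc.isOpen_compl.mem_nhds fun h ↦ hTs h rfl)
      obtain ⟨C, hC, hCc, hCs⟩ := exists_mem_nhds_isClosed_subset h1
      exact ⟨coe F '' C, isOpenEmbedding_coe.image_mem_nhds.2 hC,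
        isClosed_image hCc (mem_of_superset hT fun z hz hzC ↦ (hCs hzC).2 hz),
        image_subset_iff.2 fun z hz ↦ (hCs hz).1⟩
  exact {}

theorem infty_notMem_closure (ho : ∀ S ∈ F, ∃ T ∈ F, IsOpen T ∧ T ⊆ S)
    (hs : ∀ C : Set Y, C.Countable → Cᶜ ∈ F) {B : Set (FilterExtension F)} (hB : B.Countable)
    (h : infty F ∉ B) : infty F ∉ closure B := by
  rw [← mem_compl_iff, ← interior_compl, mem_interior_iff_mem_nhds, mem_nhds_infty ho]
  exact ⟨h, hs _ (hB.preimage coe_injective)⟩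

theorem not_countablyTight [F.NeBot] (ho : ∀ S ∈ F, ∃ T ∈ F, IsOpen T ∧ T ⊆ S)
    (hs : ∀ C : Set Y, C.Countable → Cᶜ ∈ F) : ¬ CountablyTight (FilterExtension F) := by
  intro h
  obtain ⟨B, hBA, hB, hx⟩ := h (range (coe F)) (infty F) (mem_closure_iff_nhds.2 fun U hU ↦ by
    obtain ⟨y, hy⟩ := F.nonempty_of_mem ((mem_nhds_infty ho).1 hU).2
    exact ⟨coe F y, hy, mem_range_self y⟩)
  refine infty_notMem_closure ho hs hB (fun hi ↦ ?_) hx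
  obtain ⟨y, hy⟩ := hBA hi
  exact coe_ne_infty y hy

/-- A discrete set is countable by hereditary Lindelöfness, so the new point is not a limit of its
other points and is isolated in the closure if it lies there. Old points inherit a countable base
from the open subspace `Y`. -/
theorem firstCountableTopology_closure [FirstCountableTopology Y] [HereditarilyLindelofSpace Y]
    (ho : ∀ S ∈ F, ∃ T ∈ F, IsOpen T ∧ T ⊆ S)
    (hs : ∀ C : Set Y, C.Countable → Cᶜ ∈ F) {D : Set (FilterExtension F)} (hD : IsDiscrete D) :
    FirstCountableTopology (closure D) := by
  have := hereditarilyLindelofSpace (F := F)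
  have hcount : D.Countable := (HereditarilyLindelofSpace.isLindelof D).countable_of_isDiscrete hD
  refine ⟨fun ⟨x, hx⟩ ↦ ?_⟩
  rw [nhds_subtype_eq_comap]
  rcases eq_infty_or_coe x with rfl | ⟨y, rfl⟩
  · have h1 : (closure (D \ {infty F}))ᶜ ∈ 𝓝 (infty F) :=
      isClosed_closure.isOpen_compl.mem_nhds
        (infty_notMem_closure ho hs (hcount.mono sdiff_subset) (fun h ↦ h.2 rfl))
    have h2 : closure D ⊆ closure (D \ {infty F}) ∪ {infty F} := by
      refine closure_minimal (fun z hz ↦ ?_) ?_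
      · by_cases h : z = infty F
        · exact .inr h
        · exact .inl (subset_closure ⟨hz, h⟩)
      · refine isClosed_closure.union ?_
        simpa using isClosed_insert_image (F := F) isClosed_empty
    have h3 : comap ((↑) : closure D → FilterExtension F) (𝓝 (infty F))
        = pure ⟨infty F, hx⟩ := by
      refine le_antisymm ?_ ?_
      · rw [le_pure_iff]
        refine ⟨_, h1, fun z hz ↦ ?_⟩
        rcases h2 z.2 with h | h
        · exact absurd h hz
        · exact Subtype.ext h
      · rw [← nhds_subtype_eq_comap]
        exact pure_le_nhds _
    rw [h3]
    infer_instance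
  · have : (𝓝 (coe F y)).IsCountablyGenerated := by
      rw [← isOpenEmbedding_coe.map_nhds_eq]
      infer_instance
    infer_instance

end FilterExtension

/-! ### Towers of open sets in a nonseparable space. -/

theorem exists_gt_of_countable {ι : Type*} [LinearOrder ι] [Uncountable ι]
    (hι : ∀ i : ι, (Iio i).Countable) {s : Set ι} (hs : s.Countable) : ∃ a, ∀ i ∈ s, i < a := by
  by_contra! h
  refine not_countable_univ (α := ι) ((hs.biUnion fun i _ ↦ (hι i).insert i).mono fun a _ ↦ ?_)
  obtain ⟨i, hi, hai⟩ := h a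
  exact mem_iUnion₂.2 ⟨i, hi, hai.eq_or_lt⟩

theorem exists_type_omega_one : ∃ (ι : Type) (_ : LinearOrder ι) (_ : WellFoundedLT ι)
    (_ : Uncountable ι), Cardinal.mk ι = ℵ₁ ∧ ∀ i : ι, (Iio i).Countable := by
  have h1 : Cardinal.mk (Cardinal.aleph 1).ord.ToType = ℵ₁ := by simp
  refine ⟨(Cardinal.aleph 1).ord.ToType, inferInstance, inferInstance, ?_, h1, fun i ↦ ?_⟩
  · rw [← Cardinal.aleph0_lt_mk_iff, h1]
    exact Cardinal.aleph0_lt_aleph_one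
  · have : #(Iio i) < ℵ₁ := (Cardinal.mk_Iio_lt i (by simp)).trans_eq h1
    rwa [← Cardinal.le_aleph0_iff_set_countable, ← Order.lt_succ_iff, Cardinal.succ_aleph0]

/-- The union of all open sets lying in closures of countable sets is, by hereditary Lindelöfness,
itself in the closure of one countable set. The complement of that closure works. -/
theorem exists_isOpen_hereditarily_nonseparable {K : Type*} [TopologicalSpace K]
    [HereditarilyLindelofSpace K] (hK : ¬ TopologicalSpace.SeparableSpace K) :
    ∃ U : Set K, IsOpen U ∧ U.Nonempty ∧
      ∀ V ⊆ U, V.Nonempty → IsOpen V → ∀ C : Set K, C.Countable → ¬ V ⊆ closure C := by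
  let I := {V : Set K // IsOpen V ∧ ∃ C : Set K, C.Countable ∧ V ⊆ closure C}
  obtain ⟨t, ht, htU⟩ := eq_open_union_countable (fun i : I ↦ i.1) (fun i ↦ i.2.1)
  choose C hC hCV using fun i : I ↦ i.2.2
  have hsub : ⋃ i : I, i.1 ⊆ closure (⋃ i ∈ t, C i) := by
    rw [← htU]
    exact iUnion₂_subset fun i hi ↦ (hCV i).trans (closure_mono (subset_biUnion_of_mem hi))
  refine ⟨(closure (⋃ i ∈ t, C i))ᶜ, isClosed_closure.isOpen_compl, ?_, ?_⟩
  · rw [nonempty_compl]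
    intro h
    exact hK ⟨_, ht.biUnion fun i _ ↦ hC i, dense_iff_closure_eq.2 h⟩
  · rintro V hV ⟨x, hx⟩ hVo D hD hVD
    exact hV hx (hsub (mem_iUnion.2 ⟨⟨V, hVo, D, hD, hVD⟩, hx⟩))

/-- Diagonalization: in fibre `n`, intersect as many of the first `n + 1` listed sets as keeps the
intersection nonempty. Any finitely many stages are eventually below the latest of them, so every
listed set is eventually used. -/
theorem exists_pseudointersection {ι K : Type*} [LinearOrder ι] {s : Set ι} (hs : s.Countable)
    (U : ι → ℕ → Set K) {U₀ : Set K} [TopologicalSpace K] (hU₀ : IsOpen U₀) (hne₀ : U₀.Nonempty)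
    (hU : ∀ b ∈ s, ∀ n, IsOpen (U b n)) (hne : ∀ b ∈ s, ∀ n, (U b n).Nonempty)
    (hsub : ∀ b ∈ s, ∀ n, U b n ⊆ U₀)
    (htower : ∀ b ∈ s, ∀ c ∈ s, b < c → ∀ᶠ n in atTop, U c n ⊆ U b n) :
    ∃ V : ℕ → Set K, (∀ n, IsOpen (V n) ∧ (V n).Nonempty ∧ V n ⊆ U₀) ∧
      ∀ b ∈ s, ∀ᶠ n in atTop, V n ⊆ U b n := by
  classical
  rcases s.eq_empty_or_nonempty with rfl | hse
  · exact ⟨fun _ ↦ U₀, fun _ ↦ ⟨hU₀, hne₀, subset_rfl⟩, by simp⟩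
  obtain ⟨b, rfl⟩ := hs.exists_eq_range hse
  simp only [forall_mem_range] at *
  let P : ℕ → ℕ → Prop := fun n k ↦ (⋂ j ∈ Finset.range (k + 1), U (b j) n).Nonempty
  have hP0 : ∀ n, P n 0 := fun n ↦ by
    simpa [P, Set.Nonempty] using hne 0 n
  have hP : ∀ k, ∀ᶠ n in atTop, P n k := fun k ↦ by
    obtain ⟨m, -, hm⟩ := Finset.exists_max_image (Finset.range (k + 1)) b ⟨0, by simp⟩
    have : ∀ᶠ n in atTop, ∀ j ∈ Finset.range (k + 1), U (b m) n ⊆ U (b j) n := by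
      rw [Filter.eventually_all_finset]
      intro j hj
      rcases (hm j hj).eq_or_lt with h | h
      · simp [h]
      · exact htower j m h
    filter_upwards [this] with n hn
    exact (hne m n).mono (subset_iInter₂ hn)
  have hspec : ∀ n, P n (Nat.findGreatest (P n) n) := fun n ↦
    Nat.findGreatest_spec (Nat.zero_le n) (hP0 n)
  refine ⟨fun n ↦ ⋂ j ∈ Finset.range (Nat.findGreatest (P n) n + 1), U (b j) n,
    fun n ↦ ⟨?_, hspec n, ?_⟩, fun k ↦ ?_⟩
  · exact isOpen_biInter_finset fun j _ ↦ hU j n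
  · exact (iInter₂_subset 0 (by simp)).trans (hsub 0 n)
  · filter_upwards [hP k, eventually_ge_atTop k] with n hn hkn
    exact iInter₂_subset k (by simpa [Nat.lt_succ_iff] using Nat.le_findGreatest hkn hn)

/-- At stage `a` a pseudointersection of the earlier stages exists because `Iio a` is countable. In
each fibre the earlier points form a countable set, which is not dense in any nonempty open subset
of `U₀`, so a new point can be separated from their closure. -/
theorem exists_tower {ι K : Type*} [LinearOrder ι] [WellFoundedLT ι]
    (hι : ∀ i : ι, (Iio i).Countable) [TopologicalSpace K] [RegularSpace K]
    [HereditarilyLindelofSpace K] (hK : ¬ TopologicalSpace.SeparableSpace K) :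
    ∃ (U : ι → ℕ → Set K) (e : ι → ℕ → K), (∀ a n, IsOpen (U a n)) ∧ (∀ a n, e a n ∈ U a n) ∧
      (∀ a, ∀ b < a, ∀ᶠ n in atTop, closure (U a n) ⊆ U b n) ∧
      ∀ a, ∀ b < a, ∀ n, e b n ∉ U a n := by
  obtain ⟨U₀, hU₀, hne₀, hns⟩ := exists_isOpen_hereditarily_nonseparable hK
  let Good : ι → (ι → ℕ → Set K × K) → (ℕ → Set K × K) → Prop := fun a f W ↦
    (∀ n, IsOpen (W n).1 ∧ (W n).2 ∈ (W n).1 ∧ (W n).1 ⊆ U₀) ∧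
    ∀ b < a, (∀ᶠ n in atTop, closure (W n).1 ⊆ (f b n).1) ∧ ∀ n, (f b n).2 ∉ (W n).1
  have hcongr : ∀ a f g W, (∀ b < a, f b = g b) → Good a f W → Good a g W := by
    intro a f g W hfg h
    refine ⟨h.1, fun b hb ↦ ?_⟩
    rw [← hfg b hb]
    exact h.2 b hb
  have : Nonempty K := hne₀.nonempty
  -- The recursion asks for a solution over every history, so goodness of the history becomes a
  -- premise; bad histories receive a dummy value.
  obtain ⟨F, hF⟩ := exists_transfinite_recursion (D := ℕ → Set K × K)
    (fun a f W ↦ (∀ b < a, Good b f (f b)) → Good a f W) (fun a f g W hfg h hg ↦ by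
      refine hcongr a f g W hfg (h fun b hb ↦ ?_)
      rw [hfg b hb]
      exact hcongr b g f _ (fun c hc ↦ (hfg c (hc.trans hb)).symm) (hg b hb)) fun a f ↦ by
    by_cases hgood : ∀ b < a, Good b f (f b)
    swap
    · exact ⟨fun _ ↦ (∅, Classical.arbitrary K), fun h ↦ absurd h hgood⟩
    obtain ⟨V, hV, hVU⟩ := exists_pseudointersection (hι a) (fun b n ↦ (f b n).1) hU₀ hne₀
      (fun b hb n ↦ ((hgood b hb).1 n).1) (fun b hb n ↦ ⟨_, ((hgood b hb).1 n).2.1⟩)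
      (fun b hb n ↦ ((hgood b hb).1 n).2.2) (fun b _ c hc hbc ↦
        ((hgood c hc).2 b hbc).1.mono fun n hn ↦ subset_closure.trans hn)
    have hstep : ∀ n, ∃ W : Set K × K, IsOpen W.1 ∧ W.2 ∈ W.1 ∧
        closure W.1 ⊆ V n \ closure ((fun b ↦ (f b n).2) '' Iio a) := fun n ↦ by
      obtain ⟨x, hx, hxC⟩ := not_subset.1 (hns (V n) (hV n).2.2 (hV n).2.1 (hV n).1 _
        ((hι a).image fun b ↦ (f b n).2))
      obtain ⟨C, hC, hCc, hCV⟩ := exists_mem_nhds_isClosed_subset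
        (((hV n).1.sdiff isClosed_closure).mem_nhds ⟨hx, hxC⟩)
      exact ⟨(interior C, x), isOpen_interior, mem_interior_iff_mem_nhds.2 hC,
        (closure_minimal interior_subset hCc).trans hCV⟩
    choose W hWo hWm hWV using hstep
    refine ⟨W, fun _ ↦ ⟨fun n ↦ ⟨hWo n, hWm n, ?_⟩, fun b hb ↦ ⟨?_, fun n hn ↦ ?_⟩⟩⟩
    · exact subset_closure.trans ((hWV n).trans (sdiff_subset.trans (hV n).2.2))
    · filter_upwards [hVU b hb] with n hn
      exact (hWV n).trans (sdiff_subset.trans hn)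
    · exact (hWV n (subset_closure hn)).2 (subset_closure ⟨b, hb, rfl⟩)
  have hall : ∀ a, Good a F (F a) := fun a ↦ by
    induction a using WellFoundedLT.induction with
    | ind a ih => exact hF a ih
  exact ⟨fun a n ↦ (F a n).1, fun a n ↦ (F a n).2, fun a n ↦ ((hall a).1 n).1,
    fun a n ↦ ((hall a).1 n).2.1, fun a b hb ↦ ((hall a).2 b hb).1,
    fun a b hb ↦ ((hall a).2 b hb).2⟩

/-! ### The extension of a subspace of `ℕ × K` by the tower filter. -/

theorem isOpen_setOf_snd_mem {K : Type*} [TopologicalSpace K] {A : ℕ → Set K}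
    (hA : ∀ n, IsOpen (A n)) : IsOpen {q : ℕ × K | q.2 ∈ A q.1} := by
  have : {q : ℕ × K | q.2 ∈ A q.1} = ⋃ n, {n} ×ˢ A n := by
    ext ⟨n, x⟩; simp
  rw [this]
  exact isOpen_iUnion fun n ↦ (isOpen_discrete _).prod (hA n)

theorem isClosed_setOf_snd_mem {K : Type*} [TopologicalSpace K] {A : ℕ → Set K}
    (hA : ∀ n, IsClosed (A n)) : IsClosed {q : ℕ × K | q.2 ∈ A q.1} :=
  ⟨isOpen_setOf_snd_mem fun n ↦ (hA n).isOpen_compl⟩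

theorem hereditarilyLindelofSpace_nat_prod {K : Type*} [TopologicalSpace K]
    [HereditarilyLindelofSpace K] : HereditarilyLindelofSpace (ℕ × K) := by
  refine ⟨fun t _ ↦ ?_⟩
  have : t = ⋃ n, Prod.mk n '' (Prod.mk n ⁻¹' t) := by
    ext ⟨n, x⟩; simp
  rw [this]
  exact isLindelof_iUnion fun n ↦ (HereditarilyLindelofSpace.isLindelof _).image (by fun_prop)

/-- A limit of a sequence involves only countably many indices, and these are bounded. -/
theorem exists_countable_initial_closure {ι K : Type*} [LinearOrder ι] [Uncountable ι]
    (hι : ∀ i : ι, (Iio i).Countable) [TopologicalSpace K] [FirstCountableTopology K]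
    (e : ι → K) {x : K} (hx : x ∈ closure (range e)) : ∃ a, x ∈ closure (e '' Iio a) := by
  obtain ⟨u, hu, hux⟩ := mem_closure_iff_seq_limit.1 hx
  choose i hi using hu
  obtain ⟨a, ha⟩ := exists_gt_of_countable hι (countable_range i)
  exact ⟨a, mem_closure_of_tendsto hux (.of_forall fun n ↦ ⟨i n, ha _ (mem_range_self n), hi n⟩)⟩

theorem exists_space_of_compact_nonseparable {K : Type u} [TopologicalSpace K] [CompactSpace K]
    [T2Space K] [HereditarilyLindelofSpace K] (hK : ¬ TopologicalSpace.SeparableSpace K) :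
    ∃ (X : Type u) (_ : TopologicalSpace X),
      SigmaCompactSpace X ∧ HereditarilyLindelofSpace X ∧ T3Space X ∧
      (∀ D : Set X, IsDiscrete D → FirstCountableTopology (closure D)) ∧
      ¬ CountablyTight X := by
  have := firstCountableTopology_of_hereditarilyLindelof K
  obtain ⟨ι, _, _, _, -, hι⟩ := exists_type_omega_one
  obtain ⟨U, e, hUo, heU, htower, havoid⟩ := exists_tower hι hK
  -- Restricting to the closures of the points `e a n` is what makes complements of countable sets
  -- belong to the filter.
  let S : Set (ℕ × K) := {q | q.2 ∈ closure (range fun a ↦ e a q.1)}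
  have hS : IsClosed S := 
    isClosed_setOf_snd_mem (A := fun n ↦ closure (range fun a ↦ e a n)) fun n ↦ isClosed_closure
  have : SigmaCompactSpace S := hS.isClosedEmbedding_subtypeVal.sigmaCompactSpace
  have := hereditarilyLindelofSpace_nat_prod (K := K)
  let T : ι → ℕ → Set S := fun a N ↦ {q | N ≤ q.1.1 ∧ q.1.2 ∈ U a q.1.1}
  have hTanti : ∀ a, ∀ b ≤ a, ∀ N, ∃ N', T a N' ⊆ T b N := fun a b hb N ↦ by
    rcases hb.eq_or_lt with rfl | hb
    · exact ⟨N, subset_rfl⟩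
    obtain ⟨M, hM⟩ := eventually_atTop.1 (htower a b hb)
    exact ⟨max M N, fun q hq ↦ ⟨(le_max_right _ _).trans hq.1,
      hM _ ((le_max_left _ _).trans hq.1) (subset_closure hq.2)⟩⟩
  let F : Filter S :=
    { sets := {A | ∃ a N, T a N ⊆ A}
      univ_sets := ⟨Classical.arbitrary ι, 0, subset_univ _⟩
      sets_of_superset := fun ⟨a, N, h⟩ hA ↦ ⟨a, N, h.trans hA⟩
      inter_sets := by
        rintro A B ⟨a, N, hA⟩ ⟨b, M, hB⟩
        obtain ⟨N', hN'⟩ := hTanti (max a b) a (le_max_left _ _) N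
        obtain ⟨M', hM'⟩ := hTanti (max a b) b (le_max_right _ _) M
        exact ⟨max a b, max N' M', fun q hq ↦
          ⟨hA (hN' ⟨(le_max_left _ _).trans hq.1, hq.2⟩),
            hB (hM' ⟨(le_max_right _ _).trans hq.1, hq.2⟩)⟩⟩ }
  have hF : ∀ {A : Set S}, A ∈ F ↔ ∃ a N, T a N ⊆ A := Iff.rfl
  have : F.NeBot := by
    refine ⟨fun h ↦ ?_⟩
    obtain ⟨a, N, hN⟩ := hF.1 (empty_mem_iff_bot.2 h)
    exact hN (show (⟨(N, e a N), subset_closure ⟨a, rfl⟩⟩ : S) ∈ T a N from ⟨le_rfl, heU a N⟩)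
  have ho : ∀ A ∈ F, ∃ B ∈ F, IsOpen B ∧ B ⊆ A := by
    rintro A ⟨a, N, h⟩
    refine ⟨T a N, ⟨a, N, subset_rfl⟩, ?_, h⟩
    have : IsOpen {q : ℕ × K | q.2 ∈ {x | N ≤ q.1 ∧ x ∈ U a q.1}} :=
      isOpen_setOf_snd_mem (A := fun n ↦ {x | N ≤ n ∧ x ∈ U a n}) fun n ↦
        isOpen_const.and (hUo a n)
    exact this.preimage continuous_subtype_val
  have hc : ∀ A ∈ F, ∃ B ∈ F, IsClosed B ∧ B ⊆ A := by
    rintro A ⟨b, N, h⟩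
    obtain ⟨a, ha⟩ := exists_gt_of_countable hι (countable_singleton b)
    obtain ⟨M, hM⟩ := eventually_atTop.1 (htower a b (ha b rfl))
    refine ⟨{q | max M N ≤ q.1.1 ∧ q.1.2 ∈ closure (U a q.1.1)},
      ⟨a, max M N, fun q hq ↦ ⟨hq.1, subset_closure hq.2⟩⟩, ?_, fun q hq ↦ h
        ⟨(le_max_right _ _).trans hq.1, hM _ ((le_max_left _ _).trans hq.1) hq.2⟩⟩
    have : IsClosed {q : ℕ × K | q.2 ∈ {x | max M N ≤ q.1 ∧ x ∈ closure (U a q.1)}} :=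
      isClosed_setOf_snd_mem (A := fun n ↦ {x | max M N ≤ n ∧ x ∈ closure (U a n)}) fun n ↦
        (isClosed_const (p := max M N ≤ n)).inter isClosed_closure
    exact this.preimage continuous_subtype_val
  -- Each point of `C` is in the closure of an initial part of the `e b n`. A stage `a` beyond all
  -- these parts has `U a n` open and disjoint from them, hence from `C`.
  have hs : ∀ C : Set S, C.Countable → Cᶜ ∈ F := by
    intro C hC
    choose γ hγ using fun q : S ↦ exists_countable_initial_closure hι (fun a ↦ e a q.1.1) q.2
    obtain ⟨a, ha⟩ := exists_gt_of_countable hι (hC.image γ)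
    refine ⟨a, 0, fun q hq hqC ↦ ?_⟩
    obtain ⟨_, hyU, b, hb, rfl⟩ := mem_closure_iff.1 (hγ q) _ (hUo a _) hq.2
    exact havoid a b (lt_trans hb (ha _ ⟨q, hqC, rfl⟩)) _ hyU
  exact ⟨FilterExtension F, inferInstance, FilterExtension.sigmaCompactSpace,
    FilterExtension.hereditarilyLindelofSpace,
    FilterExtension.t3Space ho hc fun y ↦ hs _ (countable_singleton y),
    fun D hD ↦ FilterExtension.firstCountableTopology_closure ho hs hD,
    FilterExtension.not_countablyTight ho hs⟩

/-! ### Suslin lines and their completions. -/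

theorem CountableChainCondition.exists_countable_subset_closure {X ι : Type*}
    [TopologicalSpace X] (hX : CountableChainCondition X) (U : ι → Set X)
    (hU : ∀ i, IsOpen (U i)) :
    ∃ t : Set ι, t.Countable ∧ ⋃ i, U i ⊆ closure (⋃ i ∈ t, U i) := by
  rcases isEmpty_or_nonempty ι with _ | _
  · exact ⟨∅, countable_empty, by simp⟩
  -- A maximal disjoint family of nonempty open sets refining `U` is countable by ccc and must be
  -- dense in `⋃ i, U i`.
  obtain ⟨M, hM⟩ := zorn_subset
    {W : Set (Set X) | (∀ V ∈ W, (IsOpen V ∧ V.Nonempty) ∧ ∃ i, V ⊆ U i) ∧ W.PairwiseDisjoint id}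
    (fun c hc hchain ↦ ⟨⋃₀ c, ⟨fun V ⟨W, hW, hV⟩ ↦ (hc hW).1 V hV,
      (pairwiseDisjoint_sUnion hchain.directedOn).2 fun W hW ↦ (hc hW).2⟩,
      fun W hW ↦ subset_sUnion_of_mem hW⟩)
  have hcount := hX M (fun V hV ↦ (hM.prop.1 V hV).1) hM.prop.2
  choose! i hi using fun V hV ↦ (hM.prop.1 V hV).2
  refine ⟨i '' M, hcount.image i, fun x hx ↦ ?_⟩
  obtain ⟨j, hj⟩ := mem_iUnion.1 hx
  by_contra hxc
  have hMs : ∀ V ∈ M, V ⊆ closure (⋃ k ∈ i '' M, U k) := fun V hV ↦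
    (hi V hV).trans ((subset_biUnion_of_mem (mem_image_of_mem i hV)).trans subset_closure)
  have hO : U j \ closure (⋃ k ∈ i '' M, U k) ∈ M := by
    refine hM.le_of_ge (y := insert (U j \ closure (⋃ k ∈ i '' M, U k)) M)
      ⟨?_, ?_⟩ (subset_insert _ _) (mem_insert _ _)
    · rintro V (rfl | hV)
      · exact ⟨⟨(hU j).sdiff isClosed_closure, x, hj, hxc⟩, j, sdiff_subset⟩
      · exact hM.prop.1 V hV
    · refine hM.prop.2.insert fun V hV _ ↦ ?_
      exact disjoint_sdiff_left.mono_right (hMs V hV)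
  exact hxc (hMs _ hO ⟨hj, hxc⟩)

theorem CountableChainCondition.exists_countable_cofinal {X : Type*} [LinearOrder X]
    [TopologicalSpace X] [OrderTopology X] (hX : CountableChainCondition X) (Q : Set X) :
    ∃ B ⊆ Q, B.Countable ∧ ∀ z ∈ Q, ∃ b ∈ B, z ≤ b := by
  by_cases hmax : ∃ m ∈ Q, ∀ z ∈ Q, z ≤ m
  · obtain ⟨m, hm, h⟩ := hmax
    exact ⟨{m}, by simpa, countable_singleton m, fun z hz ↦ ⟨m, rfl, h z hz⟩⟩
  push Not at hmax
  obtain ⟨t, ht, hsub⟩ := hX.exists_countable_subset_closure (fun q : Q ↦ Iio q.1)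
    fun q ↦ isOpen_Iio
  refine ⟨(↑) '' t, by simp, ht.image _, fun z hz ↦ ?_⟩
  -- Two steps up are needed: `w` must lie in some `Iio w'`, with `Ioi z` a neighbourhood of it.
  obtain ⟨w, hw, hzw⟩ := hmax z hz
  obtain ⟨w', hw', hww'⟩ := hmax w hw
  obtain ⟨y, hzy, hy⟩ := mem_closure_iff.1 (hsub (mem_iUnion.2 ⟨⟨w', hw'⟩, hww'⟩)) (Ioi z)
    isOpen_Ioi hzw
  obtain ⟨b, hb, hyb⟩ := mem_iUnion₂.1 hy
  exact ⟨b, mem_image_of_mem _ hb, (lt_trans hzy hyb).le⟩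

/-- Relate two points when the interval between them is covered by countably many `U i`. The classes
are open and disjoint, so ccc leaves countably many; each is exhausted by intervals to a countable
cofinal and coinitial set. -/
theorem CountableChainCondition.hereditarilyLindelofSpace {X : Type*} [LinearOrder X]
    [TopologicalSpace X] [OrderTopology X] (hX : CountableChainCondition X) :
    HereditarilyLindelofSpace X := by
  refine ⟨fun s _ ↦ isLindelof_of_countable_subcover fun {ι} U hU hs ↦ ?_⟩
  suffices h : ∃ t : Set ι, t.Countable ∧ ⋃ i, U i ⊆ ⋃ i ∈ t, U i by
    obtain ⟨t, ht, h⟩ := h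
    exact ⟨t, ht, hs.trans h⟩
  let R : X → X → Prop := fun x y ↦ ∃ t : Set ι, t.Countable ∧ uIcc x y ⊆ ⋃ i ∈ t, U i
  have hsymm : ∀ {x y}, R x y → R y x := fun ⟨t, ht, h⟩ ↦ ⟨t, ht, by rwa [uIcc_comm]⟩
  have htrans : ∀ {x y z}, R x y → R y z → R x z := fun ⟨t, ht, h⟩ ⟨t', ht', h'⟩ ↦
    ⟨t ∪ t', ht.union ht', uIcc_subset_uIcc_union_uIcc.trans (by
      rw [biUnion_union]; exact union_subset_union h h')⟩
  have hopen : ∀ x, IsOpen {y | R x y} := fun x ↦ isOpen_iff_mem_nhds.2 fun y hy ↦ by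
    obtain ⟨t, ht, h⟩ := hy
    obtain ⟨i, hi, hyi⟩ := mem_iUnion₂.1 (h right_mem_uIcc)
    have h1 : Tendsto (fun z ↦ uIcc y z) (𝓝 y) (𝓝 y).smallSets :=
      tendsto_const_nhds.uIcc tendsto_id
    filter_upwards [h1.eventually (eventually_smallSets_subset.2 ((hU i).mem_nhds hyi))] with z hz
    exact htrans ⟨t, ht, h⟩ ⟨{i}, countable_singleton i, by simpa using hz⟩
  have hrefl : ∀ x ∈ ⋃ i, U i, R x x := fun x hx ↦ by
    obtain ⟨i, hi⟩ := mem_iUnion.1 hx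
    exact ⟨{i}, countable_singleton i, by simpa using hi⟩
  have hclass : ∀ x, ∃ t : Set ι, t.Countable ∧ {y | R x y} ⊆ ⋃ i ∈ t, U i := fun x ↦ by
    obtain ⟨B, hBQ, hB, hBc⟩ := hX.exists_countable_cofinal {y | R x y}
    obtain ⟨B', hBQ', hB', hBc'⟩ :=
      CountableChainCondition.exists_countable_cofinal (X := Xᵒᵈ) hX {y | R x y}
    choose! t ht htU using fun y (hy : R x y) ↦ hy
    refine ⟨⋃ b ∈ B ∪ B', t b, (hB.union hB').biUnion fun b hb ↦ ht b ?_, fun z hz ↦ ?_⟩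
    · exact hb.elim (fun h ↦ hBQ h) fun h ↦ hBQ' h
    · have key : ∃ b ∈ B ∪ B', R x b ∧ z ∈ uIcc x b := by
        rcases le_total x z with hxz | hxz
        · obtain ⟨b, hb, hzb⟩ := hBc z hz
          exact ⟨b, .inl hb, hBQ hb, mem_uIcc.2 (.inl ⟨hxz, hzb⟩)⟩
        · obtain ⟨b, hb, hzb⟩ := hBc' z hz
          exact ⟨b, .inr hb, hBQ' hb, mem_uIcc.2 (.inr ⟨hzb, hxz⟩)⟩
      obtain ⟨b, hb, hxb, hzb⟩ := key
      obtain ⟨i, hi, hzi⟩ := mem_iUnion₂.1 (htU b hxb hzb)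
      exact mem_iUnion₂.2 ⟨i, mem_iUnion₂.2 ⟨b, hb, hi⟩, hzi⟩
  have hcount : ((fun x ↦ {y | R x y}) '' ⋃ i, U i).Countable := by
    refine hX _ ?_ ?_
    · rintro _ ⟨x, hx, rfl⟩
      exact ⟨hopen x, x, hrefl x hx⟩
    · rintro _ ⟨x, hx, rfl⟩ _ ⟨y, hy, rfl⟩ hne
      refine disjoint_left.2 fun z (hxz : R x z) (hyz : R y z) ↦ hne ?_
      ext w
      exact ⟨fun h ↦ htrans hyz (htrans (hsymm hxz) h), fun h ↦ htrans hxz (htrans (hsymm hyz) h)⟩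
  choose t ht htU using hclass
  obtain ⟨A, hA, hAc, hAeq⟩ : ∃ A : Set X, A ⊆ ⋃ i, U i ∧ A.Countable ∧
      (fun x ↦ {y | R x y}) '' A = (fun x ↦ {y | R x y}) '' ⋃ i, U i := by
    obtain ⟨A, hA, hbij⟩ := (surjOn_image (fun x ↦ {y | R x y}) (⋃ i, U i)).exists_bijOn_subset
    refine ⟨A, hA, countable_of_injective_of_countable_image hbij.injOn ?_, hbij.image_eq⟩
    rwa [hbij.image_eq]
  refine ⟨⋃ x ∈ A, t x, hAc.biUnion fun x _ ↦ ht x, fun y hy ↦ ?_⟩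
  obtain ⟨x, hx, hxy⟩ := hAeq.symm ▸ mem_image_of_mem (fun x ↦ {y | R x y}) hy
  have hy' : y ∈ {z | R x z} := by
    rw [show {z | R x z} = {z | R y z} from hxy]; exact hrefl y hy
  obtain ⟨i, hi, hyi⟩ := mem_iUnion₂.1 (htU x hy')
  exact mem_iUnion₂.2 ⟨i, mem_iUnion₂.2 ⟨x, hx, hi⟩, hyi⟩

theorem CountableChainCondition.of_denseRange {X Y : Type*} [TopologicalSpace X]
    [TopologicalSpace Y] (hX : CountableChainCondition X) {f : X → Y} (hf : Continuous f)
    (hd : DenseRange f) : CountableChainCondition Y := by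
  intro W hW hdisj
  have hne : ∀ V ∈ W, (f ⁻¹' V).Nonempty := fun V hV ↦ by
    obtain ⟨x, hx⟩ := hd.exists_mem_open (hW V hV).1 (hW V hV).2
    exact ⟨x, hx⟩
  have hdis : ∀ V ∈ W, ∀ V' ∈ W, V ≠ V' → Disjoint (f ⁻¹' V) (f ⁻¹' V') :=
    fun V hV V' hV' h ↦ (hdisj hV hV' h).preimage f
  refine countable_of_injective_of_countable_image (f := preimage f) (fun V hV V' hV' h ↦ ?_)
    (hX _ ?_ ?_)
  · by_contra hVV
    have := hdis V hV V' hV' hVV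
    rw [h, disjoint_self] at this
    exact (hne V' hV').ne_empty this
  · rintro _ ⟨V, hV, rfl⟩
    exact ⟨(hW V hV).1.preimage hf, hne V hV⟩
  · rintro _ ⟨V, hV, rfl⟩ _ ⟨V', hV', rfl⟩ h
    exact hdis V hV V' hV' fun hVV ↦ h (by rw [hVV])

theorem DedekindCut.denseRange_principal {α : Type*} [LinearOrder α] [Nonempty α]
    [TopologicalSpace (DedekindCut α)] [OrderTopology (DedekindCut α)] :
    DenseRange (DedekindCut.principal : α → DedekindCut α) := by
  refine fun c ↦ mem_closure_iff_nhds.2 fun O hO ↦ ?_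
  by_cases h1 : ∃ a, a < c
  · obtain ⟨a, ha, hsub⟩ := exists_Ioc_subset_of_mem_nhds hO h1
    obtain ⟨x, hax, hxc⟩ := DedekindCut.lt_iff_exists.1 ha
    exact ⟨_, hsub ⟨hax, hxc⟩, mem_range_self x⟩
  by_cases h2 : ∃ b, c < b
  · obtain ⟨b, hb, hsub⟩ := exists_Ico_subset_of_mem_nhds hO h2
    obtain ⟨x, hcx, hxb⟩ := DedekindCut.lt_iff_exists'.1 hb
    exact ⟨_, hsub ⟨hcx, hxb⟩, mem_range_self x⟩
  push Not at h1 h2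
  obtain ⟨x⟩ := ‹Nonempty α›
  refine ⟨_, ?_, mem_range_self x⟩
  rw [le_antisymm (h2 (DedekindCut.principal x)) (h1 _)]
  exact mem_of_mem_nhds hO

theorem DedekindCut.isInducing_principal {α : Type*} [LinearOrder α] [TopologicalSpace α]
    [OrderTopology α] [TopologicalSpace (DedekindCut α)] [OrderTopology (DedekindCut α)] :
    IsInducing (DedekindCut.principal : α → DedekindCut α) := by
  refine ⟨?_⟩
  rw [OrderTopology.topology_eq_generate_intervals (α := α)]
  refine (induced_topology_eq_preorder (f := DedekindCut.principal)
    DedekindCut.principal_lt_principal (fun {a b x} h _ ↦ ?_) fun {a b x} h _ ↦ ?_).symm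
  · obtain ⟨y, hy, hya⟩ := DedekindCut.lt_iff_exists'.1 h
    exact ⟨y, DedekindCut.principal_lt_principal.1 hya, hy⟩
  · obtain ⟨y, hy, hya⟩ := DedekindCut.lt_iff_exists.1 h
    exact ⟨y, DedekindCut.principal_lt_principal.1 hy, hya⟩

/-- Replace each point of a countable dense set by a sequence from the range converging to it. -/
theorem IsInducing.separableSpace_of_denseRange {X Y : Type*} [TopologicalSpace X]
    [TopologicalSpace Y] [FirstCountableTopology Y] [TopologicalSpace.SeparableSpace Y] {f : X → Y}
    (hf : IsInducing f) (hd : DenseRange f) : TopologicalSpace.SeparableSpace X := by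
  obtain ⟨C, hC, hCd⟩ := TopologicalSpace.exists_countable_dense Y
  choose u hu hux using fun y : Y ↦ mem_closure_iff_seq_limit.1 (hd y)
  choose v hv using hu
  refine ⟨⋃ y ∈ C, range (v y), hC.biUnion fun y _ ↦ countable_range _, ?_⟩
  rw [dense_iff_closure_eq, hf.closure_eq_preimage_closure_image, eq_univ_iff_forall]
  refine fun x ↦ closure_minimal (fun y hy ↦ ?_) isClosed_closure (hCd (f x))
  refine mem_closure_of_tendsto (hux y) (.of_forall fun n ↦ ⟨v y n, ?_, hv y n⟩)
  exact mem_iUnion₂.2 ⟨y, hy, mem_range_self n⟩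

theorem IsSuslinLine.exists_compact_nonseparable {L : Type u} [LinearOrder L]
    (hL : IsSuslinLine L) : ∃ (K : Type u) (_ : TopologicalSpace K), CompactSpace K ∧ T2Space K ∧
      HereditarilyLindelofSpace K ∧ ¬ TopologicalSpace.SeparableSpace K := by
  let : TopologicalSpace L := Preorder.topology L
  have : OrderTopology L := ⟨rfl⟩
  let : TopologicalSpace (DedekindCut L) := Preorder.topology (DedekindCut L)
  have : OrderTopology (DedekindCut L) := ⟨rfl⟩
  obtain ⟨hccc, hsep⟩ := hL
  have : Nonempty L := by
    by_contra h
    rw [not_nonempty_iff] at h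
    exact hsep inferInstance
  have hHL := (hccc.of_denseRange DedekindCut.continuous_principal
    DedekindCut.denseRange_principal).hereditarilyLindelofSpace
  have := firstCountableTopology_of_hereditarilyLindelof (DedekindCut L)
  refine ⟨DedekindCut L, inferInstance, inferInstance, inferInstance, hHL, fun h ↦ hsep ?_⟩
  exact IsInducing.separableSpace_of_denseRange DedekindCut.isInducing_principal
    DedekindCut.denseRange_principal

/-! ### Cylinders and open sets depending on countably many coordinates. -/

section Cylinders

variable {ι : Type*}

/-- The set of points of `ι → Bool` taking the values prescribed by `c`. -/
def boolCylinder (c : Finset (ι × Bool)) : Set (ι → Bool) := {x | ∀ p ∈ c, x p.1 = p.2}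

theorem boolCylinder_eq_biInter (c : Finset (ι × Bool)) :
    boolCylinder c = ⋂ p ∈ c, (fun x : ι → Bool ↦ x p.1) ⁻¹' {p.2} := by
  ext; simp [boolCylinder]

theorem isOpen_boolCylinder (c : Finset (ι × Bool)) : IsOpen (boolCylinder c) := by
  rw [boolCylinder_eq_biInter]
  exact isOpen_biInter_finset fun p _ ↦ (isOpen_discrete _).preimage (continuous_apply p.1)

theorem isClosed_boolCylinder (c : Finset (ι × Bool)) : IsClosed (boolCylinder c) := by
  rw [boolCylinder_eq_biInter]
  exact isClosed_biInter fun p _ ↦ (isClosed_discrete _).preimage (continuous_apply p.1)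

theorem measurableSet_boolCylinder (c : Finset (ι × Bool)) : MeasurableSet (boolCylinder c) := by
  rw [boolCylinder_eq_biInter]
  exact Finset.measurableSet_biInter _ fun p _ ↦ measurable_pi_apply p.1 (measurableSet_singleton _)

/-- The values of `z` on `F`. -/
def boolRestrict [DecidableEq ι] (z : ι → Bool) (F : Finset ι) : Finset (ι × Bool) :=
  F.image fun i ↦ (i, z i)

theorem mem_boolCylinder_boolRestrict [DecidableEq ι] {z x : ι → Bool} {F : Finset ι} :
    x ∈ boolCylinder (boolRestrict z F) ↔ ∀ i ∈ F, x i = z i := by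
  simp [boolCylinder, boolRestrict]

theorem IsOpen.exists_forall_eq_subset {O : Set (ι → Bool)} (hO : IsOpen O) {x : ι → Bool}
    (hx : x ∈ O) : ∃ F : Finset ι, ∀ y, (∀ i ∈ F, y i = x i) → y ∈ O := by
  obtain ⟨F, u, hu, hsub⟩ := isOpen_pi_iff.1 hO x hx
  exact ⟨F, fun y hy ↦ hsub fun i hi ↦ by rw [hy i hi]; exact (hu i hi).2⟩

end Cylinders

section Below

variable {ι : Type*} [LinearOrder ι]

/-- Membership in `A` is determined by the coordinates below `b`. -/
def DependsBelow (b : ι) (A : Set (ι → Bool)) : Prop :=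
  ∀ ⦃x y : ι → Bool⦄, (∀ i < b, x i = y i) → x ∈ A → y ∈ A

/-- The σ-algebra generated by the coordinates below `b`. -/
@[reducible] def sigmaBelow (b : ι) : MeasurableSpace (ι → Bool) :=
  ⨆ i ∈ Iio b, MeasurableSpace.comap (fun x ↦ x i) inferInstance

namespace DependsBelow

variable {b : ι} {A B : Set (ι → Bool)}

theorem compl (h : DependsBelow b A) : DependsBelow b Aᶜ :=
  fun _ _ hxy hx hy ↦ hx (h (fun i hi ↦ (hxy i hi).symm) hy)

theorem inter (hA : DependsBelow b A) (hB : DependsBelow b B) : DependsBelow b (A ∩ B) :=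
  fun _ _ hxy hx ↦ ⟨hA hxy hx.1, hB hxy hx.2⟩

theorem sdiff (hA : DependsBelow b A) (hB : DependsBelow b B) : DependsBelow b (A \ B) :=
  hA.inter hB.compl

theorem iUnion {κ : Sort*} {A : κ → Set (ι → Bool)} (h : ∀ k, DependsBelow b (A k)) :
    DependsBelow b (⋃ k, A k) := fun _ _ hxy hx ↦ by
  obtain ⟨k, hk⟩ := mem_iUnion.1 hx
  exact mem_iUnion.2 ⟨k, h k hxy hk⟩

theorem union (hA : DependsBelow b A) (hB : DependsBelow b B) : DependsBelow b (A ∪ B) :=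
  fun _ _ hxy hx ↦ hx.imp (hA hxy) (hB hxy)

theorem of_boolCylinder {c : Finset (ι × Bool)} (hc : ∀ p ∈ c, p.1 < b) :
    DependsBelow b (boolCylinder c) := fun _ _ hxy hx p hp ↦ by
  rw [← hxy _ (hc p hp)]; exact hx p hp

theorem biUnion_boolCylinder {s : Set (Finset (ι × Bool))} (hs : ∀ c ∈ s, ∀ p ∈ c, p.1 < b) :
    DependsBelow b (⋃ c ∈ s, boolCylinder c) :=
  .iUnion fun c ↦ .iUnion fun hc ↦ .of_boolCylinder (hs c hc)

theorem exists_boolCylinder (hA : DependsBelow b A) (hAo : IsOpen A) {x : ι → Bool} (hx : x ∈ A) :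
    ∃ c : Finset (ι × Bool), (∀ p ∈ c, p.1 < b) ∧ x ∈ boolCylinder c ∧
      boolCylinder c ⊆ A := by
  obtain ⟨F, hF⟩ := hAo.exists_forall_eq_subset hx
  refine ⟨boolRestrict x (F.filter (· < b)), ?_, ?_, fun y hy ↦ ?_⟩
  · intro p hp
    obtain ⟨i, hi, rfl⟩ := Finset.mem_image.1 hp
    exact (Finset.mem_filter.1 hi).2
  · simp [mem_boolCylinder_boolRestrict]
  · rw [mem_boolCylinder_boolRestrict] at hy
    -- Splice `y` below `b` with `x` from `b` on: the splice agrees with `x` on all of `F`, and `A`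
    -- cannot tell it from `y`.
    refine hA (x := fun i ↦ if i < b then y i else x i) (fun i hi ↦ by simp [hi])
      (hF _ fun i hi ↦ ?_)
    split_ifs with h
    · exact hy i (by simp [hi, h])
    · rfl

theorem exists_eq_biUnion (hA : DependsBelow b A) (hAo : IsOpen A) :
    ∃ s : Set (Finset (ι × Bool)), (∀ c ∈ s, ∀ p ∈ c, p.1 < b) ∧
      A = ⋃ c ∈ s, boolCylinder c := by
  refine ⟨{c | (∀ p ∈ c, p.1 < b) ∧ boolCylinder c ⊆ A}, fun c hc ↦ hc.1,
    subset_antisymm (fun x hx ↦ ?_) (iUnion₂_subset fun c hc ↦ hc.2)⟩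
  obtain ⟨c, hcb, hxc, hc⟩ := hA.exists_boolCylinder hAo hx
  exact mem_iUnion₂.2 ⟨c, ⟨hcb, hc⟩, hxc⟩

end DependsBelow

theorem countable_setOf_forall_lt {b : ι} (hb : (Iio b).Countable) :
    {c : Finset (ι × Bool) | ∀ p ∈ c, p.1 < b}.Countable := by
  have h := countable_ofPred_finite_subset (hb.prod (countable_univ (α := Bool)))
  refine countable_of_injective_of_countable_image (f := ((↑) : Finset (ι × Bool) → Set (ι × Bool)))
    Finset.coe_injective.injOn (h.mono ?_)
  rintro _ ⟨c, hc, rfl⟩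
  exact ⟨c.finite_toSet, fun p hp ↦ ⟨hc p hp, mem_univ _⟩⟩

theorem sigmaBelow_le (b : ι) : sigmaBelow b ≤ MeasurableSpace.pi :=
  iSup₂_le fun i _ ↦ (measurable_pi_apply i).comap_le

theorem sigmaBelow_mono {a b : ι} (h : a ≤ b) : sigmaBelow a ≤ sigmaBelow b :=
  biSup_mono fun _ hi ↦ lt_of_lt_of_le hi h

theorem measurableSet_sigmaBelow_eval {b i : ι} (h : i < b) (v : Bool) :
    MeasurableSet[sigmaBelow b] {x : ι → Bool | x i = v} :=
  le_iSup₂ (f := fun i (_ : i ∈ Iio b) ↦ MeasurableSpace.comap (fun x : ι → Bool ↦ x i) inferInstance)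
    i h _ ⟨{v}, measurableSet_singleton v, rfl⟩

theorem measurableSet_sigmaBelow_boolCylinder {b : ι} {c : Finset (ι × Bool)}
    (hc : ∀ p ∈ c, p.1 < b) : MeasurableSet[sigmaBelow b] (boolCylinder c) := by
  rw [boolCylinder_eq_biInter]
  exact MeasurableSet.biInter c.countable_toSet fun p hp ↦
    measurableSet_sigmaBelow_eval (hc p hp) p.2

/-- Only countably many cylinders live below `b`, so the union is countable; arbitrary open sets in
an uncountable product need not be measurable. -/
theorem DependsBelow.measurableSet_of_isOpen {b : ι} (hb : (Iio b).Countable) {A : Set (ι → Bool)}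
    (hA : DependsBelow b A) (hAo : IsOpen A) : MeasurableSet[sigmaBelow b] A := by
  obtain ⟨s, hs, rfl⟩ := hA.exists_eq_biUnion hAo
  exact MeasurableSet.biUnion ((countable_setOf_forall_lt hb).mono hs) fun c hc ↦
    measurableSet_sigmaBelow_boolCylinder (hs c hc)

theorem DependsBelow.measurableSet_of_isClosed {b : ι} (hb : (Iio b).Countable)
    {A : Set (ι → Bool)} (hA : DependsBelow b A) (hAc : IsClosed A) :
    MeasurableSet[sigmaBelow b] A :=
  MeasurableSet.of_compl (hA.compl.measurableSet_of_isOpen hb hAc.isOpen_compl)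

/-- `Q` is a countable intersection of clopen sets, whose finite intersections have measures tending
to zero. -/
theorem DependsBelow.exists_isOpen_superset_measure_lt {b : ι} (hb : (Iio b).Countable)
    (μ : Measure (ι → Bool)) [IsFiniteMeasure μ] {Q : Set (ι → Bool)} (hQ : DependsBelow b Q)
    (hQc : IsClosed Q) (hQ0 : μ Q = 0) {ε : ℝ≥0∞} (hε : 0 < ε) :
    ∃ O, IsOpen O ∧ DependsBelow b O ∧ Q ⊆ O ∧ μ O < ε := by
  obtain ⟨s, hs, hQs⟩ := hQ.compl.exists_eq_biUnion hQc.isOpen_compl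
  rcases s.eq_empty_or_nonempty with rfl | hne
  · have : Q = univ := by simpa using hQs
    exact ⟨Q, this ▸ isOpen_univ, hQ, subset_rfl, hQ0 ▸ hε⟩
  obtain ⟨f, rfl⟩ := ((countable_setOf_forall_lt hb).mono hs).exists_eq_range hne
  have hQf : Q = ⋂ n, (boolCylinder (f n))ᶜ := by
    rw [← compl_compl Q, hQs]; simp
  have hlim := tendsto_measure_iInter_le (μ := μ) (f := fun n ↦ (boolCylinder (f n))ᶜ)
    (fun n ↦ (measurableSet_boolCylinder _).compl.nullMeasurableSet) ⟨0, measure_ne_top _ _⟩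
  rw [← hQf, hQ0] at hlim
  obtain ⟨n, hn⟩ := (hlim.eventually (gt_mem_nhds hε)).exists
  refine ⟨_, ?_, ?_, ?_, hn⟩
  · exact (finite_Iic n).isOpen_biInter fun j _ ↦ (isClosed_boolCylinder _).isOpen_compl
  · intro x y hxy hx
    simp only [mem_iInter] at hx ⊢
    exact fun j hj ↦ (DependsBelow.of_boolCylinder (hs _ (mem_range_self j))).compl hxy (hx j hj)
  · rw [hQf]
    exact subset_iInter₂ fun j _ ↦ iInter_subset _ j

/-- There is a small open set containing every member of a given countable family of closed sets
that it almost contains. -/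
theorem exists_isOpen_forall_subset_of_measure_sdiff_eq_zero {b : ι} (hb : (Iio b).Countable)
    (μ : Measure (ι → Bool)) [IsProbabilityMeasure μ] {𝒬 : Set (Set (ι → Bool))}
    (h𝒬 : 𝒬.Countable) (hcl : ∀ Q ∈ 𝒬, IsClosed Q ∧ DependsBelow b Q) :
    ∃ W, IsOpen W ∧ DependsBelow b W ∧ μ W < 1 ∧ ∀ Q ∈ 𝒬, μ (Q \ W) = 0 → Q ⊆ W := by
  rcases 𝒬.eq_empty_or_nonempty with rfl | hne
  · exact ⟨∅, isOpen_empty, fun _ _ _ h ↦ h, by simp, by simp⟩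
  obtain ⟨Q, rfl⟩ := h𝒬.exists_eq_range hne
  simp only [forall_mem_range] at *
  -- The second component is a budget bounding the measure of everything still to be added; it
  -- starts at `1 / 2`.
  let S := {p : Set (ι → Bool) × ℝ≥0∞ // (IsOpen p.1 ∧ DependsBelow b p.1) ∧ 0 < p.2}
  have hstep : ∀ (n : ℕ) (p : S), ∃ p' : S, p.1.1 ⊆ p'.1.1 ∧
      μ (p'.1.1 \ p.1.1) + p'.1.2 ≤ p.1.2 ∧ (Q n ⊆ p'.1.1 ∨ p'.1.2 < μ (Q n \ p'.1.1)) := by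
    rintro n ⟨⟨W, δ⟩, ⟨hWo, hWd⟩, hδ⟩
    by_cases h0 : μ (Q n \ W) = 0
    · obtain ⟨O, hO, hOd, hQO, hOδ⟩ := ((hcl n).2.sdiff hWd).exists_isOpen_superset_measure_lt hb μ
        ((hcl n).1.sdiff hWo) h0 (ENNReal.half_pos hδ.ne')
      refine ⟨⟨⟨W ∪ O, δ / 2⟩, ⟨hWo.union hO, hWd.union hOd⟩, ENNReal.half_pos hδ.ne'⟩,
        subset_union_left, ?_, .inl fun x hx ↦ ?_⟩
      · calc μ ((W ∪ O) \ W) + δ / 2 ≤ δ / 2 + δ / 2 := by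
              gcongr
              exact (measure_mono (by rw [union_sdiff_left]; exact sdiff_subset)).trans hOδ.le
          _ = δ := ENNReal.add_halves δ
      · by_cases hxW : x ∈ W
        exacts [.inl hxW, .inr (hQO ⟨hx, hxW⟩)]
    -- When `Q n` is not almost covered, cutting the budget below the measure of the uncovered part
    -- guarantees that it never will be.
    · refine ⟨⟨⟨W, min δ (μ (Q n \ W) / 2)⟩, ⟨hWo, hWd⟩, lt_min hδ (ENNReal.half_pos h0)⟩,
        subset_rfl, by simp, .inr ((min_le_right _ _).trans_lt ?_)⟩
      exact ENNReal.half_lt_self h0 (measure_ne_top _ _)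
  choose next hsub hδ hQ using hstep
  let p : ℕ → S := fun n ↦ Nat.rec
    ⟨⟨∅, 1 / 2⟩, ⟨isOpen_empty, fun _ _ _ h ↦ h⟩, by simp⟩ next n
  have hp : ∀ n, p (n + 1) = next n (p n) := fun n ↦ rfl
  have hmono : Monotone fun n ↦ (p n).1.1 := monotone_nat_of_le_succ fun n ↦ by
    rw [hp]; exact hsub n (p n)
  have hbound : ∀ n k, μ ((p (n + k)).1.1 \ (p n).1.1) + (p (n + k)).1.2 ≤ (p n).1.2 := by
    intro n k
    induction k with
    | zero => simp
    | succ k ih =>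
      refine le_trans ?_ ih
      have h1 : (p (n + (k + 1))).1.1 \ (p n).1.1 ⊆
          ((p (n + k)).1.1 \ (p n).1.1) ∪ ((p (n + k + 1)).1.1 \ (p (n + k)).1.1) := by
        rintro x ⟨hx, hxn⟩
        by_cases hk : x ∈ (p (n + k)).1.1
        exacts [.inl ⟨hk, hxn⟩, .inr ⟨hx, hk⟩]
      have h2 := hδ (n + k) (p (n + k))
      rw [← hp] at h2
      calc _ ≤ μ ((p (n + k)).1.1 \ (p n).1.1) + μ ((p (n + k + 1)).1.1 \ (p (n + k)).1.1)
            + (p (n + k + 1)).1.2 := by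
              exact add_le_add ((measure_mono h1).trans (measure_union_le _ _)) le_rfl
        _ ≤ _ := by rw [add_assoc]; exact add_le_add le_rfl h2
  have hlim : ∀ n, μ ((⋃ m, (p m).1.1) \ (p n).1.1) ≤ (p n).1.2 := fun n ↦ by
    rw [iUnion_sdiff, Monotone.measure_iUnion fun i j hij ↦ sdiff_subset_sdiff_left (hmono hij)]
    refine iSup_le fun m ↦ ?_
    refine (measure_mono (sdiff_subset_sdiff_left (hmono (Nat.le_add_left m n)))).trans ?_
    exact le_self_add.trans (hbound n m)
  refine ⟨⋃ m, (p m).1.1, isOpen_iUnion fun m ↦ (p m).2.1.1, .iUnion fun m ↦ (p m).2.1.2, ?_,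
    fun n hn ↦ ?_⟩
  · have h0 : p 0 = ⟨⟨∅, 1 / 2⟩, ⟨isOpen_empty, fun _ _ _ h ↦ h⟩, by simp⟩ := rfl
    have h1 := hlim 0
    rw [h0] at h1
    simp only [sdiff_empty] at h1
    exact h1.trans_lt (by simp)
  · have h := hQ n (p n)
    rw [← hp] at h
    refine (h.resolve_right fun h ↦ ?_).trans (subset_iUnion (fun m ↦ (p m).1.1) (n + 1))
    refine h.not_ge ((measure_mono (t := (Q n \ ⋃ m, (p m).1.1) ∪
      ((⋃ m, (p m).1.1) \ (p (n + 1)).1.1)) ?_).trans ((measure_union_le _ _).trans ?_))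
    · rintro x ⟨hx, hxn⟩
      by_cases hk : x ∈ ⋃ m, (p m).1.1
      exacts [.inr ⟨hk, hxn⟩, .inl ⟨hx, hk⟩]
    · rw [hn, zero_add]
      exact hlim (n + 1)

end Below

/-- Exhaustion: a countable subfamily whose union has the largest possible measure cannot be
improved by one more set. -/
theorem exists_countable_forall_measure_sdiff_eq_zero {α κ : Type*} [MeasurableSpace α]
    (μ : Measure α) [IsFiniteMeasure μ] (C : Set κ) {A : κ → Set α}
    (hA : ∀ c ∈ C, MeasurableSet (A c)) :
    ∃ s ⊆ C, s.Countable ∧ ∀ c ∈ C, μ (A c \ ⋃ i ∈ s, A i) = 0 := by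
  let M : Set ℝ≥0∞ := (fun s : Set κ ↦ μ (⋃ i ∈ s, A i)) '' {s | s ⊆ C ∧ s.Countable}
  have hne : M.Nonempty := ⟨_, ∅, ⟨empty_subset _, countable_empty⟩, rfl⟩
  obtain ⟨u, -, hu, huM⟩ := exists_seq_tendsto_sSup hne (OrderTop.bddAbove M)
  choose s hs hsu using huM
  have hC : ⋃ n, s n ⊆ C := iUnion_subset fun n ↦ (hs n).1
  have hc : (⋃ n, s n).Countable := countable_iUnion fun n ↦ (hs n).2
  have hle : sSup M ≤ μ (⋃ i ∈ ⋃ n, s n, A i) := le_of_tendsto' hu fun n ↦ by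
    rw [← hsu]
    exact measure_mono (biUnion_mono (subset_iUnion s n) fun _ _ ↦ subset_rfl)
  refine ⟨_, hC, hc, fun c hcC ↦ ?_⟩
  have h1 : μ (A c ∪ ⋃ i ∈ ⋃ n, s n, A i) ≤ μ (⋃ i ∈ ⋃ n, s n, A i) := by
    rw [← biUnion_insert]
    have hm : μ (⋃ i ∈ insert c (⋃ n, s n), A i) ∈ M :=
      ⟨_, ⟨insert_subset hcC hC, hc.insert c⟩, rfl⟩
    exact (le_sSup hm).trans hle
  have hmeas : MeasurableSet (⋃ i ∈ ⋃ n, s n, A i) :=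
    MeasurableSet.biUnion hc fun i hi ↦ hA i (hC hi)
  rw [← union_sdiff_right, measure_sdiff subset_union_right hmeas.nullMeasurableSet
    (measure_ne_top _ _)]
  exact tsub_eq_zero_of_le h1

/-- The fair coin. -/
noncomputable def coinMeasure : Measure Bool :=
  (2⁻¹ : ℝ≥0∞) • (Measure.dirac true + Measure.dirac false)

theorem coinMeasure_singleton (v : Bool) : coinMeasure {v} = 2⁻¹ := by
  cases v <;> simp [coinMeasure]

instance : IsProbabilityMeasure coinMeasure :=
  ⟨by simp [coinMeasure, ENNReal.inv_two_add_inv_two]⟩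

theorem measurableSet_eval_eq {ι : Type*} (b : ι) (v : Bool) :
    MeasurableSet {x : ι → Bool | x b = v} :=
  (measurableSet_singleton v).preimage (measurable_pi_apply b)

theorem isClopen_eval_eq {ι : Type*} (b : ι) (v : Bool) : IsClopen {x : ι → Bool | x b = v} :=
  (isClopen_discrete {v}).preimage (continuous_apply b)

/-- The closed set of all `x` such that `x b = false` whenever `x ∈ V b`. -/
def prunedSpace {ι : Type*} (V : ι → Set (ι → Bool)) : Set (ι → Bool) := {x | ∀ b, x b = true → x ∉ V b}

theorem isClosed_prunedSpace {ι : Type*} {V : ι → Set (ι → Bool)} (hV : ∀ b, IsOpen (V b)) : IsClosed (prunedSpace V) := by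
  have : prunedSpace V = ⋂ b, ({x | x b = false} ∪ (V b)ᶜ) := by
    ext x
    simp only [prunedSpace, mem_ofPred_eq, mem_iInter, mem_union, mem_compl_iff]
    refine forall_congr' fun b ↦ ?_
    cases x b <;> simp
  rw [this]
  exact isClosed_iInter fun b ↦
    (isClopen_eval_eq b false).isClosed.union (hV b).isClosed_compl

/-! ### Pruned coin tossing and its distribution. -/

section Path

variable {ι : Type*} [LinearOrder ι]

theorem infinitePi_coinMeasure_inter {b : ι} {A : Set (ι → Bool)}
    (hA : MeasurableSet[sigmaBelow b] A) (v : Bool) :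
    Measure.infinitePi (fun _ : ι ↦ coinMeasure) (A ∩ {y | y b = v}) =
      Measure.infinitePi (fun _ : ι ↦ coinMeasure) A / 2 := by
  have h := (iIndepFun_iff_iIndep _ _ _).1 (iIndepFun_infinitePi (P := fun _ : ι ↦ coinMeasure)
    (X := fun _ x ↦ x) fun _ ↦ measurable_id)
  have h1 := indep_iSup_of_disjoint (fun i ↦ (measurable_pi_apply i).comap_le) h
    (S := Iio b) (T := {b}) (by simp)
  have h2 := (Indep_iff _ _ _).1 h1 A {y | y b = v} hA
    (le_iSup₂ (f := fun i (_ : i ∈ ({b} : Set ι)) ↦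
      MeasurableSpace.comap (fun x : ι → Bool ↦ x i) inferInstance) b rfl _
      ⟨{v}, measurableSet_singleton v, rfl⟩)
  rw [h2, ENNReal.div_eq_inv_mul, mul_comm]
  congr 1
  have h3 := (measurePreserving_eval_infinitePi (fun _ : ι ↦ coinMeasure) b).measure_preimage
    (measurableSet_singleton v).nullMeasurableSet
  rw [coinMeasure_singleton] at h3
  exact h3

variable [WellFoundedLT ι] (V : ι → Set (ι → Bool))

open Classical in
/-- The sequence obtained from `y` by replacing `y b` by `false` whenever the part already
constructed lies in `V b`. -/
noncomputable def prunedPath (y : ι → Bool) : ι → Bool :=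
  (wellFounded_lt (α := ι)).fix fun b r ↦
    y b && decide ((fun i ↦ if h : i < b then r i h else false) ∉ V b)

open Classical in
theorem prunedPath_eq (y : ι → Bool) (b : ι) : prunedPath V y b =
    (y b && decide ((fun i ↦ if i < b then prunedPath V y i else false) ∉ V b)) := by
  rw [prunedPath, WellFounded.fix_eq]
  simp only [dite_eq_ite]

theorem prunedPath_congr {V W : ι → Set (ι → Bool)} {b : ι} (h : ∀ i < b, V i = W i)
    (y : ι → Bool) (i : ι) (hi : i < b) : prunedPath V y i = prunedPath W y i := by
  induction i using WellFoundedLT.induction with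
  | ind i ih =>
    rw [prunedPath_eq, prunedPath_eq, h i hi]
    congr 4
    funext j
    split_ifs with hj
    exacts [ih j hj (hj.trans hi), rfl]

variable {V}

theorem prunedPath_eq_true_iff {b : ι} (hV : DependsBelow b (V b)) {y : ι → Bool} :
    prunedPath V y b = true ↔ y b = true ∧ prunedPath V y ∉ V b := by
  have h : (fun i ↦ if i < b then prunedPath V y i else false) ∈ V b ↔ prunedPath V y ∈ V b :=
    ⟨fun h ↦ hV (fun i hi ↦ by simp [hi]) h, fun h ↦ hV (fun i hi ↦ by simp [hi]) h⟩
  rw [prunedPath_eq, h]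
  simp

/-- The path below `b` is a function of the coins below `b`, so it is independent of the coin at
`b`; this is what the computations for `prunedMeasure` use. -/
theorem measurable_prunedPath_sigmaBelow (hι : ∀ i : ι, (Iio i).Countable)
    (hV : ∀ b, IsOpen (V b) ∧ DependsBelow b (V b)) (b : ι) :
    Measurable[sigmaBelow b, sigmaBelow b] (prunedPath V) := by
  induction b using WellFoundedLT.induction with
  | ind b ih =>
    rw [measurable_iff_comap_le, sigmaBelow, MeasurableSpace.comap_iSup]
    refine iSup_le fun i ↦ ?_
    rw [MeasurableSpace.comap_iSup]
    refine iSup_le fun hi ↦ ?_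
    rw [MeasurableSpace.comap_comp, ← measurable_iff_comap_le]
    refine @measurable_to_bool _ (sigmaBelow b) _ ?_
    have : (fun x : ι → Bool ↦ x i) ∘ prunedPath V ⁻¹' {true} =
        {y | y i = true} ∩ (prunedPath V ⁻¹' V i)ᶜ := by
      ext y
      simp [prunedPath_eq_true_iff (hV i).2]
    rw [this]
    exact (measurableSet_sigmaBelow_eval hi true).inter
      (sigmaBelow_mono (le_of_lt hi) _ (ih i hi ((hV i).2.measurableSet_of_isOpen (hι i) (hV i).1))).compl

theorem measurable_prunedPath (hι : ∀ i : ι, (Iio i).Countable)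
    (hV : ∀ b, IsOpen (V b) ∧ DependsBelow b (V b)) : Measurable (prunedPath V) := by
  refine measurable_pi_lambda _ fun b ↦ measurable_to_bool ?_
  have : (fun y ↦ prunedPath V y b) ⁻¹' {true} = {y | y b = true} ∩ (prunedPath V ⁻¹' V b)ᶜ := by
    ext y
    simp [prunedPath_eq_true_iff (hV b).2]
  rw [this]
  exact (measurableSet_eval_eq b true).inter
    (sigmaBelow_le b _ (measurable_prunedPath_sigmaBelow hι hV b
      ((hV b).2.measurableSet_of_isOpen (hι b) (hV b).1))).compl

variable (V) in
/-- The distribution of `prunedPath V` on fair coin tosses. -/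
noncomputable def prunedMeasure : Measure (ι → Bool) :=
  (Measure.infinitePi fun _ : ι ↦ coinMeasure).map (prunedPath V)

theorem isProbabilityMeasure_prunedMeasure (hι : ∀ i : ι, (Iio i).Countable)
    (hV : ∀ b, IsOpen (V b) ∧ DependsBelow b (V b)) : IsProbabilityMeasure (prunedMeasure V) :=
  Measure.isProbabilityMeasure_map (measurable_prunedPath hι hV).aemeasurable

theorem prunedMeasure_congr (hι : ∀ i : ι, (Iio i).Countable) {W : ι → Set (ι → Bool)}
    (hV : ∀ b, IsOpen (V b) ∧ DependsBelow b (V b))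
    (hW : ∀ b, IsOpen (W b) ∧ DependsBelow b (W b)) {b : ι} (h : ∀ i < b, V i = W i)
    {A : Set (ι → Bool)} (hA : MeasurableSet A) (hAb : DependsBelow b A) :
    prunedMeasure V A = prunedMeasure W A := by
  rw [prunedMeasure, prunedMeasure, Measure.map_apply (measurable_prunedPath hι hV) hA,
    Measure.map_apply (measurable_prunedPath hι hW) hA]
  congr 1
  ext y
  exact ⟨fun hy ↦ hAb (prunedPath_congr h y) hy,
    fun hy ↦ hAb (fun i hi ↦ (prunedPath_congr h y i hi).symm) hy⟩

theorem prunedMeasure_inter_true (hι : ∀ i : ι, (Iio i).Countable)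
    (hV : ∀ b, IsOpen (V b) ∧ DependsBelow b (V b)) {b : ι} {A : Set (ι → Bool)}
    (hA : MeasurableSet[sigmaBelow b] A) :
    prunedMeasure V (A ∩ {x | x b = true}) = prunedMeasure V (A \ V b) / 2 := by
  have hm : MeasurableSet[sigmaBelow b] (A \ V b) :=
    hA.diff ((hV b).2.measurableSet_of_isOpen (hι b) (hV b).1)
  rw [prunedMeasure, Measure.map_apply (measurable_prunedPath hι hV)
    ((sigmaBelow_le b _ hA).inter (measurableSet_eval_eq b true)),
    Measure.map_apply (measurable_prunedPath hι hV) (sigmaBelow_le b _ hm),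
    ← infinitePi_coinMeasure_inter (measurable_prunedPath_sigmaBelow hι hV b hm) true]
  congr 1
  ext y
  simp only [mem_preimage, mem_inter_iff, mem_ofPred_eq, prunedPath_eq_true_iff (hV b).2, Set.mem_sdiff]
  tauto

theorem prunedMeasure_div_two_le_inter_false (hι : ∀ i : ι, (Iio i).Countable)
    (hV : ∀ b, IsOpen (V b) ∧ DependsBelow b (V b)) {b : ι} {A : Set (ι → Bool)}
    (hA : MeasurableSet[sigmaBelow b] A) :
    prunedMeasure V A / 2 ≤ prunedMeasure V (A ∩ {x | x b = false}) := by
  rw [prunedMeasure, Measure.map_apply (measurable_prunedPath hι hV)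
    ((sigmaBelow_le b _ hA).inter (measurableSet_eval_eq b false)),
    Measure.map_apply (measurable_prunedPath hι hV) (sigmaBelow_le b _ hA),
    ← infinitePi_coinMeasure_inter (measurable_prunedPath_sigmaBelow hι hV b hA) false]
  refine measure_mono fun y hy ↦ ⟨hy.1, ?_⟩
  have hyb : y b = false := hy.2
  have h := prunedPath_eq_true_iff (hV b).2 (y := y)
  simpa [hyb] using h

theorem prunedMeasure_inter_of_disjoint (hι : ∀ i : ι, (Iio i).Countable)
    (hV : ∀ b, IsOpen (V b) ∧ DependsBelow b (V b)) {b : ι} {A : Set (ι → Bool)}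
    (hA : MeasurableSet[sigmaBelow b] A) (hAV : Disjoint A (V b)) (v : Bool) :
    prunedMeasure V (A ∩ {x | x b = v}) = prunedMeasure V A / 2 := by
  rw [prunedMeasure, Measure.map_apply (measurable_prunedPath hι hV)
    ((sigmaBelow_le b _ hA).inter (measurableSet_eval_eq b v)),
    Measure.map_apply (measurable_prunedPath hι hV) (sigmaBelow_le b _ hA),
    ← infinitePi_coinMeasure_inter (measurable_prunedPath_sigmaBelow hι hV b hA) v]
  congr 1
  ext y
  simp only [mem_preimage, mem_inter_iff, mem_ofPred_eq]
  refine and_congr_right fun hy ↦ ?_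
  have h := prunedPath_eq_true_iff (hV b).2 (y := y)
  have h' : prunedPath V y b = true ↔ y b = true := by
    rw [h]; exact and_iff_left (disjoint_left.1 hAV hy)
  cases v
  · simpa using not_congr h'
  · exact h'

theorem prunedPath_mem_prunedSpace (hV : ∀ b, DependsBelow b (V b)) (y : ι → Bool) :
    prunedPath V y ∈ prunedSpace V :=
  fun b hb ↦ ((prunedPath_eq_true_iff (hV b)).1 hb).2

end Path

/-- Under CH there are `𝔠 ^ ℵ₀ = 𝔠 = ℵ₁` sequences of cylinders. The values in `Option` let a
sequence also list a finite or empty family. -/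
theorem ContinuumHypothesis.exists_enumeration (hCH : ContinuumHypothesis) {ι : Type}
    (hι : #ι = ℵ₁) :
    ∃ P : ι → Set (Finset (ι × Bool)), ∀ s : Set (Finset (ι × Bool)), s.Countable → ∃ a, P a = s := by
  have hinf : Infinite ι := by
    rw [Cardinal.infinite_iff, hι]
    exact Cardinal.aleph0_le_aleph 1
  have hT : #(Option (Finset (ι × Bool))) ≤ Cardinal.continuum.{0} := by
    rw [Cardinal.mk_option, Cardinal.mk_finset_of_infinite, Cardinal.mk_prod, hι, hCH.symm]
    simp only [Cardinal.lift_id, Cardinal.mk_bool]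
    exact Cardinal.add_le_of_le Cardinal.aleph0_le_continuum
      (Cardinal.mul_le_of_le Cardinal.aleph0_le_continuum le_rfl (Cardinal.nat_lt_continuum 2).le)
      (Cardinal.one_le_aleph0.trans Cardinal.aleph0_le_continuum)
  have hseq : #(ℕ → Option (Finset (ι × Bool))) ≤ #ι := by
    rw [← Cardinal.power_def, hι, ← hCH, Cardinal.mk_nat]
    calc _ ≤ Cardinal.continuum ^ ℵ₀ := Cardinal.power_le_power_right hT
      _ = _ := Cardinal.continuum_power_aleph0
  obtain ⟨f⟩ := (Cardinal.le_def _ _).1 hseq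
  refine ⟨fun a ↦ {c | ∃ n, Function.invFun f a n = some c}, fun s hs ↦ ?_⟩
  obtain ⟨g, hg⟩ := ((hs.image some).insert none).exists_eq_range (insert_nonempty _ _)
  obtain ⟨a, ha⟩ := Function.invFun_surjective f.injective g
  refine ⟨a, ?_⟩
  ext c
  rw [mem_ofPred_eq, ha]
  change some c ∈ range g ↔ _
  simp [← hg]

/-! ### Pruning along an enumeration of closed sets. -/

section Pruned

variable {ι : Type*} [LinearOrder ι] [WellFoundedLT ι] [Uncountable ι]

/-- `V b` is a proper open set depending on the coordinates below `b`, and it contains each closed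
set from the list `P` (and each of its basic relatively open subsets) already available at `b`
as soon as it almost contains it. -/
structure IsPruning (P : ι → Set (Finset (ι × Bool))) (V : ι → Set (ι → Bool)) : Prop where
  isOpen_dependsBelow : ∀ b, IsOpen (V b) ∧ DependsBelow b (V b)
  measure_lt_one : ∀ b, prunedMeasure V (V b) < 1
  subset_of_measure_eq_zero : ∀ b, ∀ a < b, (∀ c ∈ P a, ∀ p ∈ c, p.1 < b) →
    ∀ c : Finset (ι × Bool), (∀ p ∈ c, p.1 < b) →
      prunedMeasure V ((boolCylinder c ∩ (⋃ d ∈ P a, boolCylinder d)ᶜ) \ V b) = 0 →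
        boolCylinder c ∩ (⋃ d ∈ P a, boolCylinder d)ᶜ ⊆ V b

-- The measure depends on all of `V`, but on sets determined below `b` only the earlier `V i`
-- matter. At stage `b` the history is therefore truncated by `tr` to be empty from `b` on.
omit [Uncountable ι] in
theorem exists_isPruning (hι : ∀ i : ι, (Iio i).Countable) (P : ι → Set (Finset (ι × Bool))) :
    ∃ V, IsPruning P V := by
  let tr : ι → (ι → Set (ι → Bool)) → ι → Set (ι → Bool) := fun b f i ↦ {x | i < b ∧ x ∈ f i}
  have htr : ∀ b f, ∀ i < b, tr b f i = f i := fun b f i hi ↦ by simp [tr, hi]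
  have htr' : ∀ b f, (∀ i < b, IsOpen (f i) ∧ DependsBelow i (f i)) →
      ∀ i, IsOpen (tr b f i) ∧ DependsBelow i (tr b f i) := fun b f hf i ↦ by
    by_cases hi : i < b
    · rw [htr b f i hi]; exact hf i hi
    · have : tr b f i = ∅ := by simp [tr, hi]
      rw [this]; exact ⟨isOpen_empty, fun _ _ _ h ↦ h⟩
  refine Exists.elim (exists_transfinite_recursion
    (fun (b : ι) f W ↦ (∀ i < b, IsOpen (f i) ∧ DependsBelow i (f i)) →
      (IsOpen W ∧ DependsBelow b W) ∧ prunedMeasure (tr b f) W < 1 ∧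
      ∀ a < b, (∀ c ∈ P a, ∀ p ∈ c, p.1 < b) → ∀ c : Finset (ι × Bool), (∀ p ∈ c, p.1 < b) →
        prunedMeasure (tr b f) ((boolCylinder c ∩ (⋃ d ∈ P a, boolCylinder d)ᶜ) \ W) = 0 →
          boolCylinder c ∩ (⋃ d ∈ P a, boolCylinder d)ᶜ ⊆ W) ?_ ?_) fun V hV ↦ ?_
  · intro b f g W hfg h hg
    have h1 : tr b f = tr b g := by
      funext i
      by_cases hi : i < b
      · rw [htr b f i hi, htr b g i hi, hfg i hi]
      · simp [tr, hi]
    rw [← h1]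
    exact h fun i hi ↦ by rw [hfg i hi]; exact hg i hi
  · intro b f
    by_cases hf : ∀ i < b, IsOpen (f i) ∧ DependsBelow i (f i)
    swap
    · exact ⟨∅, fun h ↦ absurd h hf⟩
    have := isProbabilityMeasure_prunedMeasure hι (htr' b f hf)
    have hcount : ((fun q : Finset (ι × Bool) × ι ↦
        boolCylinder q.1 ∩ (⋃ d ∈ P q.2, boolCylinder d)ᶜ) ''
        {q | (∀ p ∈ q.1, p.1 < b) ∧ q.2 < b ∧ ∀ c ∈ P q.2, ∀ p ∈ c, p.1 < b}).Countable :=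
      (Countable.mono (fun q hq ↦ show q ∈ {c : Finset (ι × Bool) | ∀ p ∈ c, p.1 < b} ×ˢ Iio b from
        ⟨hq.1, hq.2.1⟩) ((countable_setOf_forall_lt (hι b)).prod (hι b))).image _
    obtain ⟨W, hWo, hWd, hW1, hW⟩ := exists_isOpen_forall_subset_of_measure_sdiff_eq_zero (hι b)
      (prunedMeasure (tr b f)) hcount (by
        rintro _ ⟨q, ⟨hq1, hq2, hq3⟩, rfl⟩
        exact ⟨(isClosed_boolCylinder _).inter
          (isOpen_biUnion fun d _ ↦ isOpen_boolCylinder d).isClosed_compl,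
          (DependsBelow.of_boolCylinder hq1).inter (DependsBelow.biUnion_boolCylinder hq3).compl⟩)
    exact ⟨W, fun _ ↦ ⟨⟨hWo, hWd⟩, hW1, fun a ha hPa c hc h0 ↦
      hW _ ⟨(c, a), ⟨hc, ha, hPa⟩, rfl⟩ h0⟩⟩
  · have hVo : ∀ b, IsOpen (V b) ∧ DependsBelow b (V b) := fun b ↦ by
      induction b using WellFoundedLT.induction with
      | ind b ih => exact (hV b ih).1
    have heq : ∀ b A, DependsBelow b A → MeasurableSet[sigmaBelow b] A →
        prunedMeasure V A = prunedMeasure (tr b V) A := fun b A hA hAm ↦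
      prunedMeasure_congr hι hVo (htr' b V fun i _ ↦ hVo i) (fun i hi ↦ (htr b V i hi).symm)
        (sigmaBelow_le b _ hAm) hA
    have hVm : ∀ b, MeasurableSet[sigmaBelow b] (V b) := fun b ↦
      (hVo b).2.measurableSet_of_isOpen (hι b) (hVo b).1
    refine ⟨V, hVo, fun b ↦ ?_, fun b a ha hPa c hc h0 ↦ ?_⟩
    · rw [heq b _ (hVo b).2 (hVm b)]
      exact (hV b fun i _ ↦ hVo i).2.1
    · have hcl : IsClosed (boolCylinder c ∩ (⋃ d ∈ P a, boolCylinder d)ᶜ) :=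
        (isClosed_boolCylinder c).inter
          (isOpen_biUnion fun d _ ↦ isOpen_boolCylinder d).isClosed_compl
      have hdep : DependsBelow b (boolCylinder c ∩ (⋃ d ∈ P a, boolCylinder d)ᶜ) :=
        (DependsBelow.of_boolCylinder hc).inter (DependsBelow.biUnion_boolCylinder hPa).compl
      rw [heq b _ (hdep.sdiff (hVo b).2)
        ((hdep.measurableSet_of_isClosed (hι b) hcl).diff (hVm b))] at h0
      exact (hV b fun i _ ↦ hVo i).2.2 a ha hPa c hc h0

namespace IsPruning

variable {P : ι → Set (Finset (ι × Bool))} {V : ι → Set (ι → Bool)} (hV : IsPruning P V)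
  (hι : ∀ i : ι, (Iio i).Countable)

include hV hι

-- If `z b = true` then `z ∉ V b`, so by pruning no listed closed set containing `z` and available
-- at `b` is almost contained in `V b`. Adding the coordinates of `F` in increasing order, a value
-- `true` keeps half of the part outside `V i`, and a value `false` keeps at least half of
-- everything.
omit [Uncountable ι] in
theorem measure_boolCylinder_inter_ne_zero {γ a : ι} (ha : a < γ)
    (hPa : ∀ c ∈ P a, ∀ p ∈ c, p.1 < γ) {z : ι → Bool} (hz : z ∈ prunedSpace V)
    (hzP : z ∉ ⋃ d ∈ P a, boolCylinder d) (hzγ : ∃ b, γ ≤ b ∧ z b = true) (F : Finset ι) :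
    prunedMeasure V (boolCylinder (boolRestrict z F) ∩ (⋃ d ∈ P a, boolCylinder d)ᶜ) ≠ 0 := by
  have hself : ∀ F : Finset ι, z ∈ boolCylinder (boolRestrict z F) ∩ (⋃ d ∈ P a, boolCylinder d)ᶜ :=
    fun F ↦ ⟨mem_boolCylinder_boolRestrict.2 fun _ _ ↦ rfl, hzP⟩
  have hlt : ∀ {F : Finset ι} {b}, (∀ i ∈ F, i < b) → ∀ p ∈ boolRestrict z F, p.1 < b := by
    intro F b hF p hp
    obtain ⟨i, hi, rfl⟩ := Finset.mem_image.1 hp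
    exact hF i hi
  have hPlt : ∀ {b}, γ ≤ b → ∀ c ∈ P a, ∀ p ∈ c, p.1 < b :=
    fun hb c hc p hp ↦ (hPa c hc p hp).trans_le hb
  have hsub : ∀ {F : Finset ι} {b}, γ ≤ b → (∀ i ∈ F, i < b) → z b = true →
      prunedMeasure V ((boolCylinder (boolRestrict z F) ∩ (⋃ d ∈ P a, boolCylinder d)ᶜ) \ V b)
        ≠ 0 := fun hb hF hzb h0 ↦
    hz _ hzb (hV.subset_of_measure_eq_zero _ a (ha.trans_le hb) (hPlt hb) _ (hlt hF) h0 (hself _))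
  induction F using Finset.induction_on_max with
  | empty =>
    obtain ⟨b, hb, hzb⟩ := hzγ
    exact fun h ↦ hsub (F := ∅) hb (by simp) hzb (measure_mono_null sdiff_subset h)
  | insert i F hF ih =>
    rcases lt_or_ge i γ with hi | hi
    · obtain ⟨b, hb, hzb⟩ := hzγ
      refine fun h ↦ hsub (F := insert i F) hb (fun j hj ↦ ?_) hzb (measure_mono_null sdiff_subset h)
      rcases Finset.mem_insert.1 hj with rfl | hj
      exacts [hi.trans_le hb, (hF j hj).trans (hi.trans_le hb)]
    · have hm : MeasurableSet[sigmaBelow i]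
          (boolCylinder (boolRestrict z F) ∩ (⋃ d ∈ P a, boolCylinder d)ᶜ) :=
        (measurableSet_sigmaBelow_boolCylinder (hlt hF)).inter
          ((DependsBelow.biUnion_boolCylinder (hPlt hi)).measurableSet_of_isOpen (hι i)
            (isOpen_biUnion fun d _ ↦ isOpen_boolCylinder d)).compl
      have hins : boolCylinder (boolRestrict z (insert i F)) ∩ (⋃ d ∈ P a, boolCylinder d)ᶜ =
          (boolCylinder (boolRestrict z F) ∩ (⋃ d ∈ P a, boolCylinder d)ᶜ) ∩ {x | x i = z i} := by
        ext x
        simp only [mem_inter_iff, mem_boolCylinder_boolRestrict, Finset.forall_mem_insert,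
          mem_ofPred_eq]
        tauto
      rw [hins]
      cases hzi : z i with
      | true =>
        rw [prunedMeasure_inter_true hι hV.isOpen_dependsBelow hm]
        exact (ENNReal.half_pos (hsub hi hF hzi)).ne'
      | false =>
        exact ((ENNReal.half_pos ih).trans_le
          (prunedMeasure_div_two_le_inter_false hι hV.isOpen_dependsBelow hm)).ne'

/-- Each `b` with `z ∉ V b` is a genuine coin toss and halves the measure of agreeing with `z`.
Infinitely many of them make the agreement set `A α` null for some `α`; once listed, this closed set
is swallowed by all later `V b`. -/
theorem eventually_mem (hP : ∀ s : Set (Finset (ι × Bool)), s.Countable → ∃ a, P a = s)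
    (z : ι → Bool) : ∃ γ, ∀ b, γ ≤ b → z ∈ V b := by
  have := isProbabilityMeasure_prunedMeasure hι hV.isOpen_dependsBelow
  by_contra! h
  choose g hg hgV using h
  choose s hs using fun i : ι ↦ exists_gt_of_countable hι (countable_singleton i)
  let b : ℕ → ι := fun n ↦ Nat.rec (g (Classical.arbitrary ι)) (fun _ i ↦ g (s i)) n
  have hb : ∀ n, b (n + 1) = g (s (b n)) := fun n ↦ rfl
  have hblt : ∀ n, b n < b (n + 1) := fun n ↦ by
    rw [hb]; exact (hs _ _ rfl).trans_le (hg _)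
  have hbV : ∀ n, z ∉ V (b n) := fun n ↦ by
    cases n
    exacts [hgV _, hgV _]
  -- The set of agreement with `z` below `i`, written as the complement of a countable union of
  -- cylinders so that it occurs in the list `P`.
  let A : ι → Set (ι → Bool) := fun i ↦ (⋃ d ∈ (fun j ↦ ({(j, !z j)} : Finset (ι × Bool))) '' Iio i,
    boolCylinder d)ᶜ
  have hA : ∀ {i x}, x ∈ A i ↔ ∀ j < i, x j = z j := by
    refine fun {i x} ↦ ⟨fun hx j hj ↦ ?_, fun hx hmem ↦ ?_⟩
    · by_contra hne
      refine hx (mem_iUnion₂.2 ⟨_, ⟨j, hj, rfl⟩, fun p hp ↦ ?_⟩)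
      rw [Finset.mem_singleton.1 hp]
      exact Bool.eq_not_of_ne hne
    · obtain ⟨_, ⟨j, hj, rfl⟩, h⟩ := mem_iUnion₂.1 hmem
      simpa [hx j hj] using h (j, !z j) (Finset.mem_singleton_self _)
  have hAlt : ∀ i, ∀ c ∈ (fun j ↦ ({(j, !z j)} : Finset (ι × Bool))) '' Iio i, ∀ p ∈ c, p.1 < i := by
    rintro i _ ⟨j, hj, rfl⟩ p hp
    rw [Finset.mem_singleton.1 hp]
    exact hj
  have hAm : ∀ i, MeasurableSet[sigmaBelow i] (A i) := fun i ↦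
    ((DependsBelow.biUnion_boolCylinder (hAlt i)).measurableSet_of_isOpen (hι i)
      (isOpen_biUnion fun d _ ↦ isOpen_boolCylinder d)).compl
  have hhalf : ∀ n, prunedMeasure V (A (b (n + 1))) ≤ prunedMeasure V (A (b n)) / 2 := fun n ↦ by
    rw [← prunedMeasure_inter_of_disjoint hι hV.isOpen_dependsBelow (hAm (b n)) _ (z (b n))]
    · refine measure_mono fun x hx ↦ ⟨hA.2 fun j hj ↦ hA.1 hx j (hj.trans (hblt n)),
        hA.1 hx _ (hblt n)⟩
    · refine disjoint_left.2 fun x hx hxV ↦ hbV n ?_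
      exact (hV.isOpen_dependsBelow (b n)).2 (hA.1 hx) hxV
  have hpow : ∀ n, prunedMeasure V (A (b n)) ≤ 2⁻¹ ^ n := fun n ↦ by
    induction n with
    | zero => simpa using prob_le_one
    | succ n ih =>
      refine (hhalf n).trans ?_
      rw [pow_succ, ENNReal.div_eq_inv_mul, mul_comm]
      gcongr
  obtain ⟨α, hα⟩ := exists_gt_of_countable hι (countable_range b)
  have hnull : prunedMeasure V (A α) = 0 := by
    refine le_antisymm (ge_of_tendsto' (ENNReal.tendsto_pow_atTop_nhds_zero_of_lt_one
      (r := 2⁻¹) (by simp)) fun n ↦ le_trans (measure_mono fun x hx ↦ ?_) (hpow n)) zero_le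
    exact hA.2 fun j hj ↦ hA.1 hx j (hj.trans (hα _ (mem_range_self n)))
  obtain ⟨a, ha⟩ := hP _ ((hι α).image fun j ↦ ({(j, !z j)} : Finset (ι × Bool)))
  have hle := hg (s (max a α))
  have hlt := (hs (max a α) _ rfl).trans_le hle
  -- The empty condition gives the whole space as cylinder, so the pruning clause applies to `A α`
  -- itself.
  refine hgV (s (max a α)) (hV.subset_of_measure_eq_zero _ a ((le_max_left _ _).trans_lt hlt) ?_ ∅
    (by simp) ?_ ?_)
  · rw [ha]
    exact fun c hc p hp ↦ (hAlt α c hc p hp).trans ((le_max_right _ _).trans_lt hlt)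
  · rw [ha]
    exact measure_mono_null (sdiff_subset.trans inter_subset_right) hnull
  · rw [ha]
    exact ⟨by simp [boolCylinder], hA.2 fun _ _ ↦ rfl⟩

/-- Beyond some `b` all points of a countable set take the value `false`, but `V b` has measure less
than one, so some pruned path is `true` at `b`. -/
theorem not_separableSpace (hP : ∀ s : Set (Finset (ι × Bool)), s.Countable → ∃ a, P a = s) :
    ¬ TopologicalSpace.SeparableSpace (prunedSpace V) := by
  intro h
  have := isProbabilityMeasure_prunedMeasure hι hV.isOpen_dependsBelow
  obtain ⟨E, hE, hEd⟩ := TopologicalSpace.exists_countable_dense (prunedSpace V)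
  choose γ hγ using fun z : prunedSpace V ↦ hV.eventually_mem hι hP z.1
  obtain ⟨b, hb⟩ := exists_gt_of_countable hι (hE.image γ)
  have hVm := (hV.isOpen_dependsBelow b).2.measurableSet_of_isOpen (hι b)
    (hV.isOpen_dependsBelow b).1
  have hpos : prunedMeasure V (univ ∩ {x | x b = true}) ≠ 0 := by
    rw [prunedMeasure_inter_true hι hV.isOpen_dependsBelow MeasurableSet.univ, ← compl_eq_univ_sdiff,
      prob_compl_eq_one_sub (sigmaBelow_le b _ hVm)]
    exact (ENNReal.half_pos (tsub_pos_of_lt (hV.measure_lt_one b)).ne').ne'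
  rw [univ_inter, prunedMeasure, Measure.map_apply
    (measurable_prunedPath hι hV.isOpen_dependsBelow) (measurableSet_eval_eq b true)] at hpos
  obtain ⟨y, hy⟩ := nonempty_of_measure_ne_zero hpos
  obtain ⟨x, hxb, hxE⟩ := hEd.inter_open_nonempty {x : prunedSpace V | x.1 b = true}
    ((isClopen_eval_eq b true).isOpen.preimage continuous_subtype_val)
    ⟨⟨_, prunedPath_mem_prunedSpace (fun i ↦ (hV.isOpen_dependsBelow i).2) y⟩, hy⟩
  exact x.2 b hxb (hγ x b (hb _ ⟨x, hxE, rfl⟩).le)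

/-- Countably many cylinders refining the cover exhaust it in measure. A point of `S` left uncovered
would have a neighbourhood null outside them, which is impossible if it has a `true` coordinate at
or beyond `γ`. -/
theorem hereditarilyLindelofSpace
    (hP : ∀ s : Set (Finset (ι × Bool)), s.Countable → ∃ a, P a = s) :
    HereditarilyLindelofSpace (prunedSpace V) := by
  have := isProbabilityMeasure_prunedMeasure hι hV.isOpen_dependsBelow
  refine ⟨fun S _ ↦ isLindelof_of_countable_subcover fun {κ} U hU hSU ↦ ?_⟩
  rcases isEmpty_or_nonempty κ with _ | _
  · exact ⟨∅, countable_empty, by simpa using hSU⟩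
  let C : Set (Finset (ι × Bool)) :=
    {c | ∃ k, ∀ x : prunedSpace V, x.1 ∈ boolCylinder c → x ∈ U k}
  obtain ⟨s, hsC, hs, hnull⟩ := exists_countable_forall_measure_sdiff_eq_zero (prunedMeasure V) C
    (A := boolCylinder) fun c _ ↦ measurableSet_boolCylinder c
  obtain ⟨a, rfl⟩ := hP s hs
  obtain ⟨γ, hγ⟩ := exists_gt_of_countable hι ((countable_singleton a).union
    (hs.biUnion fun c _ ↦ (c.image Prod.fst).countable_toSet))
  have haγ : a < γ := hγ a (.inl rfl)
  have hPγ : ∀ c ∈ P a, ∀ p ∈ c, p.1 < γ := fun c hc p hp ↦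
    hγ _ (.inr (mem_iUnion₂.2 ⟨c, hc, Finset.mem_image_of_mem _ hp⟩))
  choose! k hk using fun c (hc : c ∈ P a) ↦ hsC hc
  -- The remaining points are determined by countably many coordinates and so live in a second
  -- countable space.
  let Z : Set (prunedSpace V) := {x | ∀ b, γ ≤ b → x.1 b = false}
  have hZ : IsLindelof (S ∩ Z) := by
    have := (hι γ).to_subtype
    let e : (Iio γ → Bool) → ι → Bool := fun y i ↦ if h : i < γ then y ⟨i, h⟩ else false
    have he : Continuous e := continuous_pi fun i ↦ by
      by_cases h : i < γ
      · simpa [e, h] using continuous_apply (⟨i, h⟩ : Iio γ)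
      · simpa [e, h] using continuous_const
    rw [Subtype.isLindelof_iff]
    have himg : Subtype.val '' (S ∩ Z) = e '' (e ⁻¹' (Subtype.val '' (S ∩ Z))) := by
      rw [image_preimage_eq_of_subset]
      rintro _ ⟨x, ⟨-, hx⟩, rfl⟩
      refine ⟨fun i ↦ x.1 i, funext fun i ↦ ?_⟩
      by_cases h : i < γ
      · simp [e, h]
      · simpa [e, h] using (hx i (not_lt.1 h)).symm
    rw [himg]
    exact (HereditarilyLindelofSpace.isLindelof _).image he
  obtain ⟨t, ht, htZ⟩ := hZ.elim_countable_subcover U hU (inter_subset_left.trans hSU)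
  refine ⟨k '' P a ∪ t, (hs.image k).union ht, fun x hx ↦ ?_⟩
  by_cases hxZ : x ∈ Z
  · obtain ⟨i, hi, hxi⟩ := mem_iUnion₂.1 (htZ ⟨hx, hxZ⟩)
    exact mem_iUnion₂.2 ⟨i, .inr hi, hxi⟩
  have hxP : x.1 ∈ ⋃ d ∈ P a, boolCylinder d := by
    by_contra hxP
    obtain ⟨j, hj⟩ := mem_iUnion.1 (hSU hx)
    obtain ⟨O, hO, hOU⟩ := isOpen_induced_iff.1 (hU j)
    obtain ⟨F, hF⟩ := hO.exists_forall_eq_subset (x := x.1) (by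
      rw [← hOU] at hj; exact hj)
    have hc : boolRestrict x.1 F ∈ C := ⟨j, fun y hy ↦ by
      rw [← hOU]; exact hF _ (mem_boolCylinder_boolRestrict.1 hy)⟩
    refine hV.measure_boolCylinder_inter_ne_zero hι haγ hPγ x.2 hxP ?_ F (hnull _ hc)
    simpa [Z] using hxZ
  obtain ⟨d, hd, hxd⟩ := mem_iUnion₂.1 hxP
  exact mem_iUnion₂.2 ⟨k d, .inl ⟨d, hd, rfl⟩, hk d hd x hxd⟩

end IsPruning

end Pruned

/-! ### The compactum under CH and the conclusion. -/

theorem ContinuumHypothesis.exists_compact_nonseparable (hCH : ContinuumHypothesis) :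
    ∃ (K : Type) (_ : TopologicalSpace K), CompactSpace K ∧ T2Space K ∧
      HereditarilyLindelofSpace K ∧ ¬ TopologicalSpace.SeparableSpace K := by
  obtain ⟨ι, _, _, _, hcard, hι⟩ := exists_type_omega_one
  obtain ⟨P, hP⟩ := hCH.exists_enumeration hcard
  obtain ⟨V, hV⟩ := exists_isPruning hι P
  exact ⟨prunedSpace V, inferInstance, isCompact_iff_compactSpace.1
    (isClosed_prunedSpace fun b ↦ (hV.isOpen_dependsBelow b).1).isCompact, inferInstance,
    hV.hereditarilyLindelofSpace hι hP, hV.not_separableSpace hι hP⟩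

theorem corollary2p4
    (h : (∃ (L : Type u) (_ : LinearOrder L), IsSuslinLine L) ∨ ContinuumHypothesis) :
    ∃ (X : Type u) (_ : TopologicalSpace X),
      SigmaCompactSpace X ∧ HereditarilyLindelofSpace X ∧ T3Space X ∧
      (∀ D : Set X, IsDiscrete D → FirstCountableTopology (closure D)) ∧
      ¬ CountablyTight X := by
  rcases h with ⟨L, _, hL⟩ | hCH
  · obtain ⟨K, _, _, _, _, hK⟩ := hL.exists_compact_nonseparable
    exact exists_space_of_compact_nonseparable hK
  · obtain ⟨K, _, _, _, hHL, hK⟩ := hCH.exists_compact_nonseparable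
    -- The compactum from CH lives in the lowest universe and is lifted.
    have : HereditarilyLindelofSpace (ULift.{u} K) := by
      refine ⟨fun t _ ↦ ?_⟩
      have : t = ULift.up '' (ULift.up ⁻¹' t) := by
        rw [image_preimage_eq _ ULift.up_surjective]
      rw [this]
      exact (hHL.isLindelof _).image continuous_uliftUp
    refine exists_space_of_compact_nonseparable (K := ULift.{u} K) fun hs ↦ hK ?_
    exact (ULift.down_surjective.denseRange).separableSpace continuous_uliftDown
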